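/- Let $A$ be a commutative ring with $1$. For a point $\alpha$ of the real spectrum $\operatorname{Sper}A$ (an ordering $\alpha\subseteq A$ with prime support $\operatorname{supp}\alpha=\alpha\cap-\alpha$), let $\rho(\alpha)$ be the real closure of the ordered field $\kappa(\alpha)=\operatorname{Frac}(A/\operatorname{supp}\alpha)$ and $\rho_\alpha:A\to\rho(\alpha)$ the canonical map. A point $\beta$ is a specialization of $\alpha$ if $\beta\in\overline{\{\alpha\}}$ in the topology generated by the sets $D(a)=\{\alpha:\rho_\alpha(a)>0\}$, equivalently $\alpha\subseteq\beta$. In that case let $C_{\beta\alpha}\subseteq\rho(\alpha)$ be the largest convex subring that contains $\rho_\alpha(A)$ and whose maximal ideal $m_{\beta\alpha}$ satisfies $\rho_\alpha^{-1}(m_{\beta\alpha})=\operatorname{supp}\beta$, let $\pi_{\beta\alpha}:C_{\beta\alpha}\to\rho_{\beta\alpha}=C_{\beta\alpha}/m_{\beta\alpha}$ be the projection, and let $\iota:\rho(\beta)\to\rho_{\beta\alpha}$ be the unique homomorphism with $\iota\circ\rho_\beta=\pi_{\beta\alpha}\circ\rho_\alpha$. Let $K\subseteq\operatorname{Sper}A$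 be (pro)constructible. An element $\sigma\in\prod_{\alpha\in K}\rho(\alpha)$ is a compatible section if for all $\alpha,\beta\in K$ with $\beta$ a specialization of $\alpha$ one has $\sigma(\alpha)\in C_{\beta\alpha}$ and $\pi_{\beta\alpha}(\sigma(\alpha))=\iota(\sigma(\beta))$. Let $\pi:\operatorname{Sper}A[t]\to\operatorname{Sper}A$ be induced by $A\to A[t]$, and regard $\sigma(\alpha)\in\rho(\alpha)$ as the point $\{p\in A[t]: p(\sigma(\alpha))\ge 0 \text{ in } \rho(\alpha)\}$ of the fiber $\pi^{-1}(\alpha)\subseteq\operatorname{Sper}A[t]$, where the coefficients of $p$ are mapped to $\rho(\alpha)$ by $\rho_\alpha$. Theorem. An element $\sigma\in\prod_{\alpha\in K}\rho(\alpha)$ is a compatible section if and only if, for all $\alpha,\beta\in K$ with $\beta$ a specialization of $\alpha$, the point $\sigma(\beta)$ is the unique specialization of $\sigma(\alpha)$ lying in the fiber $\pi^{-1}(\beta)$. -/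

import Mathlib

/-! ### Real closures of ordered fields -/

namespace RealClosureConstruction

open Polynomial

variable {k Ω : Type*} [Field k] [Field Ω] [Algebra k Ω]

/-- Finite sums `∑ aᵢ yᵢ²` with `aᵢ` in the cone `O` of `k` and `yᵢ ∈ S`. -/
def sums (O : RingPreordering k) (S : Set Ω) : AddSubmonoid Ω :=
  AddSubmonoid.closure {z | ∃ a ∈ O, ∃ y ∈ S, z = algebraMap k Ω a * y ^ 2}

theorem sums_mono (O : RingPreordering k) {S S' : Set Ω} (h : S ⊆ S') : sums O S ≤ sums O S' := by
  apply AddSubmonoid.closure_mono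
  rintro z ⟨a, ha, y, hy, rfl⟩
  exact ⟨a, ha, y, h hy, rfl⟩

theorem sums_le (O : RingPreordering k) (L : IntermediateField k Ω) {z : Ω}
    (hz : z ∈ sums O (L : Set Ω)) : z ∈ L := by
  induction hz using AddSubmonoid.closure_induction with
  | mem z hz =>
    obtain ⟨a, _, y, hy, rfl⟩ := hz
    exact mul_mem (L.algebraMap_mem a) (pow_mem hy 2)
  | zero => exact zero_mem L
  | add x y _ _ hx hy => exact add_mem hx hy

theorem mul_mem_sums (O : RingPreordering k) (L : IntermediateField k Ω) {z w : Ω}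
    (hz : z ∈ sums O (L : Set Ω)) (hw : w ∈ sums O (L : Set Ω)) : z * w ∈ sums O (L : Set Ω) := by
  induction hz using AddSubmonoid.closure_induction with
  | zero => simp
  | add x y _ _ hx hy => rw [add_mul]; exact add_mem hx hy
  | mem z hz =>
    induction hw using AddSubmonoid.closure_induction with
    | zero => simp
    | add x y _ _ hx hy => rw [mul_add]; exact add_mem hx hy
    | mem w hw =>
      obtain ⟨a, ha, y, hy, rfl⟩ := hz
      obtain ⟨b, hb, x, hx, rfl⟩ := hw
      refine AddSubmonoid.subset_closure ⟨a * b, mul_mem ha hb, y * x, mul_mem hy hx, ?_⟩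
      rw [map_mul]; ring

theorem sq_mem_sums (O : RingPreordering k) (L : IntermediateField k Ω) {y : Ω}
    (hy : y ∈ L) : y ^ 2 ∈ sums O (L : Set Ω) :=
  AddSubmonoid.subset_closure ⟨1, one_mem O, y, hy, by simp⟩

theorem map_mem_sums (O : RingPreordering k) (L : IntermediateField k Ω) {a : k}
    (ha : a ∈ O) : algebraMap k Ω a ∈ sums O (L : Set Ω) :=
  AddSubmonoid.subset_closure ⟨a, ha, 1, one_mem L, by simp⟩

/-- There is a maximal intermediate field to which the cone extends. -/
theorem exists_maximal (O : RingPreordering k) :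
    ∃ L : IntermediateField k Ω,
      Maximal (fun L : IntermediateField k Ω => (-1 : Ω) ∉ sums O (L : Set Ω)) L := by
  refine (zorn_le_nonempty₀ {L : IntermediateField k Ω | (-1 : Ω) ∉ sums O (L : Set Ω)}
    ?_ ⊥ ?_).imp fun L hL => hL.2
  · intro c hc hchain L₀ hL₀
    refine ⟨sSup c, ?_, fun L hL => le_sSup hL⟩
    have : Nonempty c := ⟨⟨L₀, hL₀⟩⟩
    have hdir : Directed (· ≤ ·) (fun L : c => (L : IntermediateField k Ω)) :=
      hchain.directedOn.directed_val
    have hmem : ∀ y, y ∈ sSup c → ∃ L ∈ c, y ∈ L := by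
      intro y hy
      rw [sSup_eq_iSup'] at hy
      have := (IntermediateField.coe_iSup_of_directed hdir) ▸ (SetLike.mem_coe.2 hy)
      simpa using this
    have key : ∀ z ∈ sums O ((sSup c : IntermediateField k Ω) : Set Ω),
        ∃ L ∈ c, z ∈ sums O (L : Set Ω) := by
      intro z hz
      induction hz using AddSubmonoid.closure_induction with
      | mem z hz =>
        obtain ⟨a, ha, y, hy, rfl⟩ := hz
        obtain ⟨L, hL, hyL⟩ := hmem y hy
        exact ⟨L, hL, AddSubmonoid.subset_closure ⟨a, ha, y, hyL, rfl⟩⟩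
      | zero => exact ⟨L₀, hL₀, zero_mem _⟩
      | add x y _ _ hx hy =>
        obtain ⟨L, hL, hxL⟩ := hx
        obtain ⟨M, hM, hyM⟩ := hy
        obtain ⟨N, hN, hLN, hMN⟩ := hchain.directedOn L hL M hM
        exact ⟨N, hN, add_mem (sums_mono O hLN hxL) (sums_mono O hMN hyM)⟩
    intro h
    obtain ⟨L, hL, h'⟩ := key _ h
    exact hc hL h'
  · have key : ∀ z ∈ sums O ((⊥ : IntermediateField k Ω) : Set Ω),
        ∃ a ∈ O, algebraMap k Ω a = z := by
      intro z hz
      induction hz using AddSubmonoid.closure_induction with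
      | mem z hz =>
        obtain ⟨a, ha, y, hy, rfl⟩ := hz
        obtain ⟨b, rfl⟩ := IntermediateField.mem_bot.1 hy
        exact ⟨a * b ^ 2, mul_mem ha (by simp), by simp⟩
      | zero => exact ⟨0, zero_mem O, by simp⟩
      | add x y _ _ hx hy =>
        obtain ⟨a, ha, rfl⟩ := hx
        obtain ⟨b, hb, rfl⟩ := hy
        exact ⟨a + b, add_mem ha hb, by simp⟩
    intro h
    obtain ⟨a, ha, h'⟩ := key _ h
    have : a = -1 := (algebraMap k Ω).injective (by simpa using h')
    exact O.neg_one_notMem (this ▸ ha)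

section Max

variable {O : RingPreordering k} {L : IntermediateField k Ω}

theorem neg_one_mem_adjoin
    (hL : Maximal (fun L : IntermediateField k Ω => (-1 : Ω) ∉ sums O (L : Set Ω)) L)
    {r : Ω} (hr : r ∉ L) :
    (-1 : Ω) ∈ sums O ((IntermediateField.adjoin L {r} : IntermediateField L Ω) : Set Ω) := by
  by_contra h
  have hle : L ≤ (IntermediateField.adjoin L {r}).restrictScalars k := by
    intro x hx
    exact (IntermediateField.adjoin L {r}).algebraMap_mem ⟨x, hx⟩
  exact hr (hL.2 (y := (IntermediateField.adjoin L {r}).restrictScalars k) h hle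
    (IntermediateField.mem_adjoin_simple_self L r))

theorem exists_aeval {r : Ω} {f : L[X]} (hf : f.Monic) (hr : aeval r f = 0) {y : Ω}
    (hy : y ∈ IntermediateField.adjoin L {r}) :
    ∃ g : L[X], g.degree < f.degree ∧ aeval r g = y := by
  have hint : IsIntegral L r := ⟨f, hf, by simpa [aeval_def] using hr⟩
  have h1 : y ∈ (IntermediateField.adjoin L {r}).toSubalgebra := hy
  rw [IntermediateField.adjoin_simple_toSubalgebra_of_isAlgebraic hint.isAlgebraic,
    Algebra.adjoin_singleton_eq_range_aeval] at h1
  obtain ⟨g, rfl⟩ := h1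
  refine ⟨g %ₘ f, degree_modByMonic_lt g hf, ?_⟩
  rw [modByMonic_eq_sub_mul_div g f]
  simp [hr]

theorem isSquare_or
    (hL : Maximal (fun L : IntermediateField k Ω => (-1 : Ω) ∉ sums O (L : Set Ω)) L)
    (halg : IsAlgClosed Ω) (x : L) : IsSquare x ∨ IsSquare (-x) := by
  by_contra! hcon
  have key : ∀ x : L, ¬ IsSquare x →
      ∃ s ∈ sums O (L : Set Ω), ∃ t ∈ sums O (L : Set Ω), (-1 : Ω) = s + x * t := by
    intro x hx
    obtain ⟨r, hr⟩ := IsAlgClosed.exists_pow_nat_eq (x : Ω) (n := 2) (by norm_num)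
    have hrL : r ∉ L := fun h => hx ⟨⟨r, h⟩, Subtype.ext (by simp [← hr, pow_two])⟩
    have hdec : ∀ z ∈ sums O ((IntermediateField.adjoin L {r} : IntermediateField L Ω) : Set Ω),
        ∃ s ∈ sums O (L : Set Ω), ∃ t ∈ sums O (L : Set Ω), ∃ w ∈ L, z = s + x * t + w * r := by
      intro z hz
      induction hz using AddSubmonoid.closure_induction with
      | mem z hz =>
        obtain ⟨a, ha, y, hy, rfl⟩ := hz
        obtain ⟨g, hg, rfl⟩ := exists_aeval (f := X ^ 2 - C x) (monic_X_pow_sub_C x (by norm_num))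
          (by simp [hr]) hy
        rw [degree_X_pow_sub_C (by norm_num)] at hg
        rw [eq_X_add_C_of_degree_le_one (p := g) (by
          by_cases hg0 : g = 0
          · simp [hg0]
          · rw [degree_eq_natDegree hg0] at hg ⊢
            have : g.natDegree < 2 := by exact_mod_cast hg
            exact_mod_cast (by omega : g.natDegree ≤ 1))]
        set u := g.coeff 0
        set v := g.coeff 1
        refine ⟨algebraMap k Ω a * (u : Ω) ^ 2,
          AddSubmonoid.subset_closure ⟨a, ha, u, u.2, rfl⟩, algebraMap k Ω a * (v : Ω) ^ 2,
          AddSubmonoid.subset_closure ⟨a, ha, v, v.2, rfl⟩, algebraMap k Ω a * (2 * u * v),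
          mul_mem (L.algebraMap_mem a) (mul_mem (mul_mem (by
            exact_mod_cast natCast_mem L 2) u.2) v.2), ?_⟩
        simp only [map_add, map_mul, aeval_C, aeval_X, IntermediateField.algebraMap_apply]
        rw [← hr]
        ring
      | zero => exact ⟨0, zero_mem _, 0, zero_mem _, 0, zero_mem _, by simp⟩
      | add z₁ z₂ _ _ h₁ h₂ =>
        obtain ⟨s, hs, t, ht, w, hw, rfl⟩ := h₁
        obtain ⟨s', hs', t', ht', w', hw', rfl⟩ := h₂
        exact ⟨s + s', add_mem hs hs', t + t', add_mem ht ht', w + w', add_mem hw hw', by ring⟩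
    obtain ⟨s, hs, t, ht, w, hw, h⟩ := hdec _ (neg_one_mem_adjoin hL hrL)
    have hw0 : w = 0 := by
      by_contra hw0
      apply hrL
      have : r = (-1 - s - x * t) / w := by field_simp; rw [h]; ring
      rw [this]
      exact div_mem (sub_mem (sub_mem (neg_mem (one_mem L)) (sums_le O L hs))
        (mul_mem x.2 (sums_le O L ht))) hw
    exact ⟨s, hs, t, ht, by rw [h, hw0]; ring⟩
  obtain ⟨s, hs, t, ht, h⟩ := key x hcon.1
  obtain ⟨s', hs', t', ht', h'⟩ := key (-x) hcon.2
  apply hL.1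
  have : (-1 : Ω) = s + s' + s * s' + (x : Ω) ^ 2 * (t * t') := by
    have h1 : (x : Ω) * t = -1 - s := by rw [h]; ring
    have h2 : (x : Ω) * t' = 1 + s' := by
      have : ((-x : L) : Ω) = -(x : Ω) := rfl
      rw [this] at h'
      linear_combination h'
    have : (x : Ω) ^ 2 * (t * t') = (x * t) * (x * t') := by ring
    rw [this, h1, h2]; ring
  rw [this]
  exact add_mem (add_mem (add_mem hs hs') (mul_mem_sums O L hs hs'))
    (mul_mem_sums O L (sq_mem_sums O L x.2) (mul_mem_sums O L ht ht'))

theorem isSquare_of_mem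
    (hL : Maximal (fun L : IntermediateField k Ω => (-1 : Ω) ∉ sums O (L : Set Ω)) L)
    (halg : IsAlgClosed Ω) (x : L) (hx : (x : Ω) ∈ sums O (L : Set Ω)) :
    IsSquare x := by
  rcases isSquare_or hL halg x with h | ⟨z, hz⟩
  · exact h
  by_cases hz0 : z = 0
  · exact ⟨0, by simpa [hz0] using hz⟩
  exfalso
  apply hL.1
  have : (-1 : Ω) = x * ((z⁻¹ : L) : Ω) ^ 2 := by
    have : (-1 : L) = x * z⁻¹ ^ 2 := by
      have hx : x = -(z * z) := by rw [← hz]; ring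
      rw [hx]; field_simp
    simpa using congrArg (Subtype.val) this
  rw [this]
  exact mul_mem_sums O L hx (sq_mem_sums O L (z⁻¹).2)

theorem isSquare_add
    (hL : Maximal (fun L : IntermediateField k Ω => (-1 : Ω) ∉ sums O (L : Set Ω)) L)
    (halg : IsAlgClosed Ω) {x y : L} (hx : IsSquare x) (hy : IsSquare y) :
    IsSquare (x + y) := by
  obtain ⟨x, rfl⟩ := hx
  obtain ⟨y, rfl⟩ := hy
  refine isSquare_of_mem hL halg _ ?_
  rw [← pow_two, ← pow_two]
  exact add_mem (sq_mem_sums O L x.2) (sq_mem_sums O L y.2)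

theorem not_isSquare_neg_one
    (hL : Maximal (fun L : IntermediateField k Ω => (-1 : Ω) ∉ sums O (L : Set Ω)) L)
    : ¬ IsSquare (-1 : L) := by
  rintro ⟨y, hy⟩
  apply hL.1
  have : (-1 : Ω) = (y : Ω) ^ 2 := by
    rw [pow_two]; simpa using congrArg (Subtype.val) hy
  rw [this]
  exact sq_mem_sums O L y.2

theorem eq_zero_of_isSquare
    (hL : Maximal (fun L : IntermediateField k Ω => (-1 : Ω) ∉ sums O (L : Set Ω)) L)
    {x y : L} (hx : IsSquare x) (hy : IsSquare y) (h : x + y = 0) :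
    x = 0 := by
  obtain ⟨x, rfl⟩ := hx
  obtain ⟨y, rfl⟩ := hy
  by_contra hx0
  have hx1 : x ≠ 0 := fun h => hx0 (by simp [h])
  refine not_isSquare_neg_one hL ⟨y / x, ?_⟩
  field_simp
  linear_combination -h

/-- Leading coefficients of sums of squares of polynomials over a field in which sums of
squares are squares. -/
theorem even_add
    (hL : Maximal (fun L : IntermediateField k Ω => (-1 : Ω) ∉ sums O (L : Set Ω)) L)
    (halg : IsAlgClosed Ω) {p q : L[X]}
    (hp : Even p.natDegree ∧ IsSquare p.leadingCoeff)
    (hq : Even q.natDegree ∧ IsSquare q.leadingCoeff) :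
    Even (p + q).natDegree ∧ IsSquare (p + q).leadingCoeff := by
  rcases lt_trichotomy p.degree q.degree with h | h | h
  · rw [leadingCoeff_add_of_degree_lt h, natDegree_eq_of_degree_eq (degree_add_eq_right_of_degree_lt h)]
    exact hq
  · by_cases h0 : p.leadingCoeff + q.leadingCoeff = 0
    · have hp0 : p = 0 := leadingCoeff_eq_zero.1 (eq_zero_of_isSquare hL hp.2 hq.2 h0)
      simpa [hp0] using hq
    · rw [leadingCoeff_add_of_degree_eq h h0, natDegree_eq_of_degree_eq (q := p)
        (by rw [degree_add_eq_of_leadingCoeff_add_ne_zero h0, h, max_self])]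
      exact ⟨hp.1, isSquare_add hL halg hp.2 hq.2⟩
  · rw [leadingCoeff_add_of_degree_lt' h, natDegree_eq_of_degree_eq (degree_add_eq_left_of_degree_lt h)]
    exact hp


theorem exists_root
    (hL : Maximal (fun L : IntermediateField k Ω => (-1 : Ω) ∉ sums O (L : Set Ω)) L)
    (halg : IsAlgClosed Ω) (n : ℕ) :
    ∀ f : L[X], f.natDegree = n → Odd n → ∃ x, f.IsRoot x := by
  induction n using Nat.strong_induction_on with
  | h n ih =>
  intro f hfn hn
  have hf0 : f ≠ 0 := by rintro rfl; simp at hfn; subst hfn; simp at hn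
  -- pass to a monic polynomial
  obtain ⟨F, hF, hFn, hFroot⟩ : ∃ F : L[X], F.Monic ∧ F.natDegree = n ∧
      ∀ x, F.IsRoot x → f.IsRoot x := by
    refine ⟨f * C f.leadingCoeff⁻¹, monic_mul_leadingCoeff_inv hf0, ?_, fun x hx => ?_⟩
    · rw [natDegree_mul_leadingCoeff_inv _ hf0, hfn]
    · simpa [hf0] using hx
  by_contra hno
  have hFno : ∀ x, ¬ F.IsRoot x := fun x hx => hno ⟨x, hFroot x hx⟩
  have hnpos : 0 < n := hn.pos
  -- a proper factor would yield a root
  have hirr : Irreducible F := by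
    rw [hF.irreducible_iff_natDegree]
    refine ⟨by rintro rfl; simp at hFn; omega, ?_⟩
    intro p q hp hq hpq
    have hdeg : p.natDegree + q.natDegree = n := by
      rw [← hp.natDegree_mul hq, hpq, hFn]
    by_contra! hpq0
    rcases Nat.even_or_odd p.natDegree with hpe | hpo
    · have hqo : Odd q.natDegree := by
        rcases Nat.even_or_odd q.natDegree with h | h
        · exact absurd hn (by rw [← hdeg]; simpa using hpe.add h)
        · exact h
      obtain ⟨x, hx⟩ := ih _ (by omega) q rfl hqo
      exact hFno x (by rw [← hpq]; simp [IsRoot.def.1 hx])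
    · obtain ⟨x, hx⟩ := ih _ (by omega) p rfl hpo
      exact hFno x (by rw [← hpq]; simp [IsRoot.def.1 hx])
  obtain ⟨r, hr⟩ := IsAlgClosed.exists_aeval_eq_zero Ω F
    (by rw [degree_eq_natDegree hF.ne_zero, hFn]; exact_mod_cast hnpos.ne')
  have hrL : r ∉ L := by
    intro h
    apply hFno ⟨r, h⟩
    have h2 : aeval (algebraMap L Ω ⟨r, h⟩) F = 0 := hr
    rw [aeval_algebraMap_apply] at h2
    simpa using h2
  have hdec : ∀ z ∈ sums O ((IntermediateField.adjoin L {r} : IntermediateField L Ω) : Set Ω),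
      ∃ G : L[X], (Even G.natDegree ∧ IsSquare G.leadingCoeff) ∧ G.natDegree ≤ 2 * (n - 1) ∧
        (∀ x, IsSquare (G.eval x)) ∧ aeval r G = z := by
    intro z hz
    induction hz using AddSubmonoid.closure_induction with
    | mem z hz =>
      obtain ⟨a, ha, y, hy, rfl⟩ := hz
      obtain ⟨g, hg, rfl⟩ := exists_aeval hF hr hy
      obtain ⟨b, hb⟩ := isSquare_of_mem hL halg (algebraMap k L a) (map_mem_sums O L ha)
      refine ⟨(C b * g) ^ 2, ⟨?_, ?_⟩, ?_, ?_, ?_⟩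
      · rw [natDegree_pow]; exact even_two_mul _
      · rw [leadingCoeff_pow]; exact ⟨_, pow_two _⟩
      · rw [natDegree_pow]
        have h1 : (C b * g).natDegree ≤ g.natDegree := natDegree_C_mul_le b g
        have h2 : g.natDegree < n := by
          by_cases hg0 : g = 0
          · simpa [hg0] using hnpos
          · rw [← hFn]
            exact natDegree_lt_natDegree hg0 hg
        omega
      · intro x; rw [eval_pow]; exact ⟨_, pow_two _⟩
      · have : algebraMap k Ω a = algebraMap L Ω (b * b) := by rw [← hb]; rfl
        rw [this]
        simp
        ring
    | zero => exact ⟨0, by simp, by simp, by simp, by simp⟩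
    | add z₁ z₂ _ _ h₁ h₂ =>
      obtain ⟨G, hG, hGn, hGs, rfl⟩ := h₁
      obtain ⟨H, hH, hHn, hHs, rfl⟩ := h₂
      refine ⟨G + H, even_add hL halg hG hH, (natDegree_add_le _ _).trans (max_le hGn hHn),
        fun x => ?_, by simp⟩
      rw [eval_add]
      exact isSquare_add hL halg (hGs x) (hHs x)
  obtain ⟨G, hG, hGn, hGs, hGr⟩ := hdec _ (neg_one_mem_adjoin hL hrL)
  have hone : Even (1 : L[X]).natDegree ∧ IsSquare (1 : L[X]).leadingCoeff := by simp
  have hG1 := even_add hL halg hG hone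
  have hnz : ∀ x, (G + 1).eval x ≠ 0 := by
    intro x hx
    rw [eval_add, eval_one] at hx
    apply not_isSquare_neg_one hL
    rw [← eq_neg_of_add_eq_zero_left hx]
    exact hGs x
  have hdvd : F ∣ G + 1 := by
    rw [minpoly.eq_of_irreducible_of_monic hirr hr hF]
    apply minpoly.dvd
    simp [hGr]
  obtain ⟨h, hh⟩ := hdvd
  have hG0 : G + 1 ≠ 0 := fun h0 => hnz 0 (by simp [h0])
  have hh0 : h ≠ 0 := by rintro rfl; exact hG0 (by simpa using hh)
  have hdeg : (G + 1).natDegree = n + h.natDegree := by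
    rw [hh, natDegree_mul hF.ne_zero hh0, hFn]
  have hle : (G + 1).natDegree ≤ 2 * (n - 1) := by
    refine (natDegree_add_le _ _).trans (max_le hGn (by simp))
  have hodd : Odd h.natDegree := by
    rcases Nat.even_or_odd h.natDegree with he | ho
    · exfalso
      have := hn.add_even he
      rw [← hdeg] at this
      exact (Nat.not_even_iff_odd.2 this) hG1.1
    · exact ho
  obtain ⟨x, hx⟩ := ih h.natDegree (by omega) h rfl hodd
  apply hnz x
  rw [hh, eval_mul, IsRoot.def.1 hx, mul_zero]

end Max

/-- Every field with a cone (in particular, every ordered field) has an algebraic extension,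
inside a given algebraically closed extension, that is real closed and in which the elements
of the cone are squares. -/
theorem exists_isRealClosed [IsAlgClosed Ω] (O : RingPreordering k) :
    ∃ L : IntermediateField k Ω, IsRealClosed L ∧
      ∀ a ∈ O, IsSquare (algebraMap k L a) := by
  obtain ⟨L, hL⟩ := exists_maximal (Ω := Ω) O
  refine ⟨L, ?_, fun a ha => isSquare_of_mem hL ‹_› _ (map_mem_sums O L ha)⟩
  have : IsSemireal L := by
    refine IsSemireal.of_not_isSumSq_neg_one fun h => ?_
    have : ∀ x : L, IsSumSq x → IsSquare x := by
      intro x hx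
      induction hx with
      | zero => simp
      | sq_add a _ h => exact isSquare_add hL ‹_› ⟨a, rfl⟩ h
    exact not_isSquare_neg_one hL (this _ h)
  exact
    { isSquare_or_isSquare_neg := isSquare_or hL ‹_›
      exists_isRoot_of_odd_natDegree := fun {f} hf => exists_root hL ‹_› _ f rfl hf }

end RealClosureConstruction

/-! ### The real spectrum -/

universe u

/-- The real spectrum of a commutative ring `A`: its points are the orderings of `A`, that is,
the subsets `α` with `α ∩ -α` a prime ideal that induce a total order on `A ⧸ (α ∩ -α)`. -/
def Sper (A : Type u) [CommRing A] : Type u :=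
  {P : RingPreordering A // P.IsOrdering}

namespace Sper

section Basic

variable {A : Type u} [CommRing A]

instance : SetLike (Sper A) A where
  coe α := (α.1 : Set A)
  coe_injective _ _ h := Subtype.ext (SetLike.coe_injective h)

instance : SubsemiringClass (Sper A) A where
  zero_mem α := zero_mem α.1
  one_mem α := one_mem α.1
  add_mem {α} := add_mem (s := α.1)
  mul_mem {α} := mul_mem (s := α.1)

instance (α : Sper A) : α.1.IsOrdering := α.2

/-- The support `α ∩ -α`, a prime ideal. -/
def supp (α : Sper A) : Ideal A := α.1.support

instance (α : Sper A) : α.supp.IsPrime := inferInstanceAs α.1.support.IsPrime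

theorem mem_supp {α : Sper A} {a : A} : a ∈ α.supp ↔ a ∈ α ∧ -a ∈ α := Iff.rfl

theorem mem_or_neg_mem (α : Sper A) (a : A) : a ∈ α ∨ -a ∈ α :=
  HasMemOrNegMem.mem_or_neg_mem α.1 a

theorem sq_mem (α : Sper A) (a : A) : a ^ 2 ∈ α := α.1.pow_two_mem a

/-- The map of real spectra induced by a ring homomorphism: inverse image of orderings. -/
def comap {B : Type*} [CommRing B] (f : A →+* B) (β : Sper B) : Sper A :=
  ⟨RingPreordering.mk' {a | f a ∈ β}
      (fun hx hy => by simpa using add_mem hx hy)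
      (fun hx hy => by simpa using mul_mem hx hy)
      (fun x => by simpa [pow_two] using β.sq_mem (f x))
      (by
        intro h
        have h' : f (-1) ∈ β := h
        rw [map_neg, map_one] at h'
        exact β.1.neg_one_notMem h'),
    RingPreordering.isOrdering_iff.2 fun a b h =>
      RingPreordering.isOrdering_iff.1 β.2 (f a) (f b) (by
        have h' : f (-(a * b)) ∈ β := h
        rwa [map_neg, map_mul] at h')⟩

@[simp] theorem mem_comap {B : Type*} [CommRing B] (f : A →+* B) (β : Sper B) (a : A) :
    a ∈ comap f β ↔ f a ∈ β := Iff.rfl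

end Basic

section ResidueFields

variable {A : Type u} [CommRing A] (α : Sper A)

/-- `κ(α)`, the fraction field of `A ⧸ supp α`. -/
abbrev kappa : Type u := FractionRing (A ⧸ α.supp)

/-- The canonical homomorphism `A → κ(α)`. -/
noncomputable def toKappa : A →+* α.kappa :=
  (algebraMap (A ⧸ α.supp) α.kappa).comp (Ideal.Quotient.mk α.supp)

theorem toKappa_eq_zero {a : A} : α.toKappa a = 0 ↔ a ∈ α.supp := by
  simp [toKappa, Ideal.Quotient.eq_zero_iff_mem]

theorem exists_toKappa_div (x : α.kappa) :
    ∃ a b : A, b ∉ α.supp ∧ x = α.toKappa a / α.toKappa b := by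
  obtain ⟨p, q, hq, rfl⟩ := IsFractionRing.div_surjective (A := A ⧸ α.supp) x
  obtain ⟨a, rfl⟩ := Ideal.Quotient.mk_surjective p
  obtain ⟨b, rfl⟩ := Ideal.Quotient.mk_surjective q
  refine ⟨a, b, fun hb => ?_, rfl⟩
  exact nonZeroDivisors.ne_zero hq (Ideal.Quotient.eq_zero_iff_mem.2 hb)

/-- The positive cone of the total order on `κ(α)`: `a / b` is nonnegative if and only if
`a b ∈ α`. -/
noncomputable def kappaCone : RingPreordering α.kappa :=
  RingPreordering.mk'
    {x | ∃ a b : A, b ∉ α.supp ∧ a * b ∈ α ∧ x = α.toKappa a / α.toKappa b}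
    (by
      rintro _ _ ⟨a, b, hb, hab, rfl⟩ ⟨c, d, hd, hcd, rfl⟩
      have hb' := mt α.toKappa_eq_zero.1 hb
      have hd' := mt α.toKappa_eq_zero.1 hd
      refine ⟨a * d + b * c, b * d, fun h => ?_, ?_, ?_⟩
      · exact (Ideal.IsPrime.mem_or_mem inferInstance h).elim hb hd
      · have : (a * d + b * c) * (b * d) = a * b * d ^ 2 + c * d * b ^ 2 := by ring
        rw [this]
        exact add_mem (mul_mem hab (α.sq_mem d)) (mul_mem hcd (α.sq_mem b))
      · simp only [map_add, map_mul]
        field_simp)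
    (by
      rintro _ _ ⟨a, b, hb, hab, rfl⟩ ⟨c, d, hd, hcd, rfl⟩
      refine ⟨a * c, b * d, fun h => ?_, ?_, ?_⟩
      · exact (Ideal.IsPrime.mem_or_mem inferInstance h).elim hb hd
      · have : a * c * (b * d) = a * b * (c * d) := by ring
        rw [this]
        exact mul_mem hab hcd
      · simp only [map_mul]
        rw [div_mul_div_comm])
    (by
      intro x
      obtain ⟨a, b, hb, rfl⟩ := α.exists_toKappa_div x
      refine ⟨a * a, b * b, fun h => ?_, ?_, ?_⟩
      · exact (Ideal.IsPrime.mem_or_mem inferInstance h).elim hb hb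
      · have : a * a * (b * b) = (a * b) ^ 2 := by ring
        rw [this]
        exact α.sq_mem _
      · simp only [map_mul]
        rw [div_mul_div_comm])
    (by
      rintro ⟨a, b, hb, hab, h⟩
      have hb' := mt α.toKappa_eq_zero.1 hb
      have h1 : a + b ∈ α.supp := by
        rw [← α.toKappa_eq_zero, map_add]
        field_simp at h
        linear_combination -h
      have h2 : -(b ^ 2) ∈ α := by
        have : -(b ^ 2) = a * b + -(b * (a + b)) := by ring
        rw [this]
        exact add_mem hab (mem_supp.1 (α.supp.mul_mem_left b h1)).2
      have h3 : b ^ 2 ∈ α.supp := mem_supp.2 ⟨α.sq_mem b, h2⟩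
      exact hb (Ideal.IsPrime.mem_of_pow_mem inferInstance 2 h3))

theorem mem_kappaCone {x : α.kappa} : x ∈ α.kappaCone ↔
    ∃ a b : A, b ∉ α.supp ∧ a * b ∈ α ∧ x = α.toKappa a / α.toKappa b := Iff.rfl

theorem toKappa_mem_kappaCone {a : A} : α.toKappa a ∈ α.kappaCone ↔ a ∈ α := by
  refine ⟨?_, fun h => ⟨a, 1, fun h1 => ?_, by simpa using h, by simp⟩⟩
  · rintro ⟨c, b, hb, hcb, h⟩
    have hb' := mt α.toKappa_eq_zero.1 hb
    by_contra ha
    have ha' : -a ∈ α := (α.mem_or_neg_mem a).resolve_left ha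
    have h1 : a * b - c ∈ α.supp := by
      rw [← α.toKappa_eq_zero, map_sub, map_mul, h]
      field_simp
      ring
    have h2 : a * b ^ 2 ∈ α := by
      have : a * b ^ 2 = c * b + b * (a * b - c) := by ring
      rw [this]
      exact add_mem hcb (mem_supp.1 (α.supp.mul_mem_left b h1)).1
    have h3 : -(a * b ^ 2) ∈ α := by
      have : -(a * b ^ 2) = -a * b ^ 2 := by ring
      rw [this]
      exact mul_mem ha' (α.sq_mem b)
    rcases Ideal.IsPrime.mem_or_mem (I := α.supp) inferInstance (mem_supp.2 ⟨h2, h3⟩) with h | h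
    · exact ha (mem_supp.1 h).1
    · exact hb (Ideal.IsPrime.mem_of_pow_mem inferInstance 2 h)
  · exact (inferInstance : α.supp.IsPrime).ne_top ((Ideal.eq_top_iff_one _).2 h1)

theorem mem_kappaCone_or_neg_mem (x : α.kappa) : x ∈ α.kappaCone ∨ -x ∈ α.kappaCone := by
  obtain ⟨a, b, hb, rfl⟩ := α.exists_toKappa_div x
  rcases α.mem_or_neg_mem (a * b) with h | h
  · exact .inl ⟨a, b, hb, h, rfl⟩
  · exact .inr ⟨-a, b, hb, by simpa using h, by simp [neg_div]⟩

/-- Existence of a real closure of the ordered field `κ(α)` in an algebraic closure. -/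
theorem exists_realClosure :
    ∃ L : IntermediateField α.kappa (AlgebraicClosure α.kappa), IsRealClosed L ∧
      ∀ x : α.kappa, IsSquare (algebraMap α.kappa L x) ↔ x ∈ α.kappaCone := by
  obtain ⟨L, hL, h⟩ := RealClosureConstruction.exists_isRealClosed
    (Ω := AlgebraicClosure α.kappa) α.kappaCone
  refine ⟨L, hL, fun x => ⟨fun hx => ?_, h x⟩⟩
  rcases α.mem_kappaCone_or_neg_mem x with h1 | h1
  · exact h1
  · by_cases hx0 : algebraMap α.kappa L x = 0
    · rw [(algebraMap α.kappa L).injective (hx0.trans (map_zero _).symm)]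
      exact zero_mem _
    · exfalso
      obtain ⟨y, hy⟩ := hx
      obtain ⟨z, hz⟩ := h _ h1
      have hy0 : y ≠ 0 := by rintro rfl; exact hx0 (by simpa using hy)
      refine IsSemireal.not_isSumSq_neg_one L ?_
      have : (-1 : L) = (z / y) * (z / y) := by
        rw [map_neg] at hz
        field_simp
        linear_combination hy + hz
      rw [this]
      exact IsSumSq.mul_self _

/-- `ρ(α)`, a real closure of the ordered field `κ(α)`: a real closed field, algebraic over
`κ(α)`, whose order (the nonnegative elements are the squares) extends the order of `κ(α)`. -/
def rho : Type u := (Classical.choose α.exists_realClosure : IntermediateField _ _)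

noncomputable instance : Field α.rho :=
  inferInstanceAs (Field (Classical.choose α.exists_realClosure : IntermediateField _ _))

noncomputable instance : Algebra α.kappa α.rho :=
  inferInstanceAs
    (Algebra α.kappa (Classical.choose α.exists_realClosure : IntermediateField _ _))

instance : Algebra.IsAlgebraic α.kappa α.rho :=
  inferInstanceAs (Algebra.IsAlgebraic α.kappa
    (Classical.choose α.exists_realClosure : IntermediateField _ _))

instance : IsRealClosed α.rho := (Classical.choose_spec α.exists_realClosure).1

theorem isSquare_algebraMap_rho (x : α.kappa) :
    IsSquare (algebraMap α.kappa α.rho x) ↔ x ∈ α.kappaCone :=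
  (Classical.choose_spec α.exists_realClosure).2 x

theorem isSquare_add_of_isRealClosed {R : Type*} [Field R] [IsRealClosed R] {x y : R}
    (hx : IsSquare x) (hy : IsSquare y) : IsSquare (x + y) := by
  rcases IsRealClosed.isSquare_or_isSquare_neg (x + y) with h | ⟨w, hw⟩
  · exact h
  obtain ⟨u, rfl⟩ := hx
  obtain ⟨v, rfl⟩ := hy
  by_cases hw0 : w = 0
  · exact ⟨0, by subst hw0; linear_combination -hw⟩
  exfalso
  refine IsSemireal.not_isSumSq_neg_one R ?_
  have : (-1 : R) = (u / w) * (u / w) + ((v / w) * (v / w) + 0) := by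
    field_simp
    linear_combination hw
  rw [this]
  exact .sq_add _ (.sq_add _ .zero)

theorem eq_zero_of_isSquare_neg {R : Type*} [Field R] [IsRealClosed R] {x : R}
    (hx : IsSquare x) (hy : IsSquare (-x)) : x = 0 := by
  obtain ⟨u, rfl⟩ := hx
  obtain ⟨v, hv⟩ := hy
  by_contra h0
  have hu : u ≠ 0 := by rintro rfl; simp at h0
  refine IsSemireal.not_isSumSq_neg_one R ?_
  have : (-1 : R) = (v / u) * (v / u) := by
    field_simp
    linear_combination hv
  rw [this]
  exact .mul_self _

open Classical in
/-- The unique order of the real closed field `ρ(α)`. -/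
noncomputable instance : LinearOrder α.rho where
  le x y := IsSquare (y - x)
  le_refl x := by simp
  le_trans x y z h h' := by
    have := isSquare_add_of_isRealClosed h h'
    rwa [sub_add_sub_cancel'] at this
  le_antisymm x y h h' := by
    have := eq_zero_of_isSquare_neg h (by rwa [neg_sub])
    exact (sub_eq_zero.1 this).symm
  le_total x y := by
    have := IsRealClosed.isSquare_or_isSquare_neg (y - x)
    rwa [neg_sub] at this
  toDecidableLE := Classical.decRel _

theorem rho_le_iff {x y : α.rho} : x ≤ y ↔ IsSquare (y - x) := Iff.rfl

theorem rho_nonneg_iff {x : α.rho} : 0 ≤ x ↔ IsSquare x := by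
  rw [rho_le_iff, sub_zero]

instance : IsStrictOrderedRing α.rho :=
  have : IsOrderedAddMonoid α.rho :=
    { add_le_add_left := fun a b h c => by
        rw [rho_le_iff] at h ⊢
        simpa using h }
  have : ZeroLEOneClass α.rho := ⟨α.rho_nonneg_iff.2 ⟨1, by simp⟩⟩
  .of_mul_pos fun a b ha hb =>
    lt_of_le_of_ne (α.rho_nonneg_iff.2 ((α.rho_nonneg_iff.1 ha.le).mul (α.rho_nonneg_iff.1 hb.le)))
      (mul_ne_zero ha.ne' hb.ne').symm

/-- The evaluation `ρ_α : A → A ⧸ supp α → κ(α) → ρ(α)`, `a ↦ a(α)`. -/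
noncomputable def ev : A →+* α.rho := (algebraMap α.kappa α.rho).comp α.toKappa

theorem ev_nonneg {a : A} : 0 ≤ α.ev a ↔ a ∈ α := by
  rw [rho_nonneg_iff, ← α.toKappa_mem_kappaCone, ← isSquare_algebraMap_rho]
  rfl

theorem ev_pos {a : A} : 0 < α.ev a ↔ -a ∉ α := by
  rw [← not_le, ← ev_nonneg, map_neg, neg_nonneg]

theorem ev_eq_zero {a : A} : α.ev a = 0 ↔ a ∈ α.supp := by
  rw [← α.toKappa_eq_zero]
  simp [ev]

/-- The point of `Sper ρ(α)` given by the order of `ρ(α)`. -/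
noncomputable def rhoPoint : Sper α.rho :=
  ⟨RingPreordering.mk' {x : α.rho | 0 ≤ x}
      (fun {x y} (hx : 0 ≤ x) (hy : 0 ≤ y) => (add_nonneg hx hy : 0 ≤ x + y))
      (fun {x y} (hx : 0 ≤ x) (hy : 0 ≤ y) => (mul_nonneg hx hy : 0 ≤ x * y))
      (fun x => (mul_self_nonneg x : 0 ≤ x * x)) (by simp),
    RingPreordering.isOrdering_iff.2 fun a b h => by
      by_contra! hab
      have ha : a < 0 := not_le.1 hab.1
      have hb : b < 0 := not_le.1 hab.2
      have h' : 0 ≤ -(a * b) := h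
      nlinarith [mul_pos_of_neg_of_neg ha hb]⟩

@[simp] theorem mem_rhoPoint {x : α.rho} : x ∈ α.rhoPoint ↔ 0 ≤ x := Iff.rfl

end ResidueFields

/-! ### The weak topology, specializations and constructible sets -/

section Topology

variable {A : Type u} [CommRing A]

/-- `D(a) = {α | a(α) > 0}`. -/
def basicOpen (a : A) : Set (Sper A) := {α | 0 < α.ev a}

theorem mem_basicOpen {a : A} {α : Sper A} : α ∈ basicOpen a ↔ -a ∉ α := α.ev_pos

/-- The weak topology, generated by the sets `D(a)`; `α ⤳ β` means that `β` lies in the closure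
of `{α}`, that is, that `β` is a specialization of `α`. -/
instance : TopologicalSpace (Sper A) := .generateFrom (Set.range basicOpen)

theorem specializes_iff {α β : Sper A} : α ⤳ β ↔ ∀ a ∈ α, a ∈ β := by
  have h1 : α ⤳ β ↔ ∀ a : A, β ∈ basicOpen a → α ∈ basicOpen a := by
    rw [Specializes, TopologicalSpace.nhds_generateFrom (a := β)]
    constructor
    · intro h a ha
      exact mem_of_mem_nhds (h.trans (iInf₂_le _ ⟨ha, a, rfl⟩) (Filter.mem_principal_self _))
    · intro h
      refine le_iInf₂ fun s hs => ?_
      obtain ⟨hβ, a, rfl⟩ := hs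
      exact Filter.le_principal_iff.2
        ((TopologicalSpace.isOpen_generateFrom_of_mem (Set.mem_range_self a)).mem_nhds (h a hβ))
  rw [h1]
  simp only [mem_basicOpen]
  refine ⟨fun h a ha => ?_, fun h a hβ hα => hβ (h _ hα)⟩
  by_contra hβ
  exact h (-a) (by rwa [neg_neg]) (by rwa [neg_neg])

/-- Constructible sets: finite Boolean combinations of the sets `D(a)`. -/
def IsConstructible (K : Set (Sper A)) : Prop :=
  K ∈ BooleanSubalgebra.closure (Set.range (basicOpen : A → Set (Sper A)))

/-- Proconstructible sets: intersections of constructible sets. -/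
def IsProconstructible (K : Set (Sper A)) : Prop :=
  ∃ S : Set (Set (Sper A)), (∀ C ∈ S, IsConstructible C) ∧ K = ⋂₀ S

end Topology

/-! ### The convex subring attached to a specialization -/

section Convex

variable {A : Type u} [CommRing A] {α β : Sper A}

/-- `C` is a convex subring of `ρ(α)` that contains the image of `A` and has a maximal ideal
whose inverse image in `A` is `supp β`. -/
structure IsConvexFor (α β : Sper A) (C : Subring α.rho) : Prop where
  ordConnected : (C : Set α.rho).OrdConnected
  ev_mem : ∀ a, α.ev a ∈ C
  exists_maximal : ∃ m : Ideal C, m.IsMaximal ∧ m.comap (α.ev.codRestrict C ev_mem) = β.supp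

/-- `C_{βα}`: the largest convex subring of `ρ(α)` containing the image of `A` and having a
maximal ideal that lies over `supp β`. -/
noncomputable def convexSubring (α β : Sper A) : Subring α.rho :=
  sSup {C | IsConvexFor α β C}

theorem mem_or_inv_mem {C : Subring α.rho} (hC : (C : Set α.rho).OrdConnected) (x : α.rho) :
    x ∈ C ∨ x⁻¹ ∈ C := by
  have h : ∀ y : α.rho, |y| ≤ 1 → y ∈ C := fun y hy =>
    hC.out (neg_mem (one_mem C)) (one_mem C) (abs_le.1 hy)
  rcases le_total |x| 1 with hx | hx
  · exact .inl (h x hx)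
  · exact .inr (h _ (by rw [abs_inv]; exact inv_le_one_of_one_le₀ hx))

theorem isLocalRing_of_ordConnected {C : Subring α.rho} (hC : (C : Set α.rho).OrdConnected) :
    IsLocalRing C :=
  let V : ValuationSubring α.rho := { C with mem_or_inv_mem' := mem_or_inv_mem hC }
  (inferInstance : IsLocalRing V)

theorem isUnit_iff_inv_mem {C : Subring α.rho} (x : C) :
    IsUnit x ↔ (x : α.rho) ≠ 0 ∧ (x : α.rho)⁻¹ ∈ C := by
  constructor
  · intro h
    obtain ⟨y, hy⟩ := h.exists_right_inv
    have hy' : (x : α.rho) * y = 1 := by exact_mod_cast congrArg Subtype.val hy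
    refine ⟨left_ne_zero_of_mul_eq_one hy', ?_⟩
    rw [inv_eq_of_mul_eq_one_right hy']
    exact y.2
  · rintro ⟨h0, h⟩
    exact IsUnit.of_mul_eq_one ⟨_, h⟩ (Subtype.ext (mul_inv_cancel₀ h0))

theorem isConvexFor_iff {C : Subring α.rho} : IsConvexFor α β C ↔
    (C : Set α.rho).OrdConnected ∧ (∀ a, α.ev a ∈ C) ∧
      ∀ a, a ∉ β.supp ↔ α.ev a ≠ 0 ∧ (α.ev a)⁻¹ ∈ C := by
  constructor
  · rintro ⟨h1, h2, m, hm, hmc⟩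
    refine ⟨h1, h2, fun a => ?_⟩
    have := isLocalRing_of_ordConnected h1
    rw [← hmc, Ideal.mem_comap, IsLocalRing.eq_maximalIdeal hm, IsLocalRing.mem_maximalIdeal,
      mem_nonunits_iff, not_not, isUnit_iff_inv_mem]
    rfl
  · rintro ⟨h1, h2, h3⟩
    have := isLocalRing_of_ordConnected h1
    refine ⟨h1, h2, IsLocalRing.maximalIdeal C, inferInstance, ?_⟩
    ext a
    rw [← not_iff_not, h3, Ideal.mem_comap, IsLocalRing.mem_maximalIdeal,
      mem_nonunits_iff, not_not, isUnit_iff_inv_mem]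
    rfl

theorem exists_isConvexFor (h : α ⤳ β) : ∃ C, IsConvexFor α β C := by
  rw [specializes_iff] at h
  let C : Subring α.rho :=
    { carrier := {x | ∃ a s, s ∉ β.supp ∧ |x| * α.ev s ^ 2 ≤ α.ev a}
      zero_mem' := ⟨0, 1, fun h1 => (inferInstance : β.supp.IsPrime).ne_top
        ((Ideal.eq_top_iff_one _).2 h1), by simp⟩
      one_mem' := ⟨1, 1, fun h1 => (inferInstance : β.supp.IsPrime).ne_top
        ((Ideal.eq_top_iff_one _).2 h1), by simp⟩
      neg_mem' := by
        rintro x ⟨a, s, hs, hx⟩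
        exact ⟨a, s, hs, by simpa using hx⟩
      add_mem' := by
        rintro x y ⟨a, s, hs, hx⟩ ⟨b, t, ht, hy⟩
        refine ⟨a * t ^ 2 + b * s ^ 2, s * t,
          fun h => (Ideal.IsPrime.mem_or_mem inferInstance h).elim hs ht, ?_⟩
        simp only [map_add, map_mul, map_pow]
        have h1 := mul_le_mul_of_nonneg_right hx (sq_nonneg (α.ev t))
        have h2 := mul_le_mul_of_nonneg_right hy (sq_nonneg (α.ev s))
        have h3 := mul_le_mul_of_nonneg_right (abs_add_le x y) (sq_nonneg (α.ev s * α.ev t))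
        linarith
      mul_mem' := by
        rintro x y ⟨a, s, hs, hx⟩ ⟨b, t, ht, hy⟩
        refine ⟨a * b, s * t,
          fun h => (Ideal.IsPrime.mem_or_mem inferInstance h).elim hs ht, ?_⟩
        simp only [map_mul, abs_mul]
        have h1 := mul_le_mul hx hy (by positivity) (le_trans (by positivity) hx)
        linarith }
  refine ⟨C, isConvexFor_iff.2 ⟨⟨?_⟩, fun a => ?_, fun a => ⟨fun ha => ?_, ?_⟩⟩⟩
  · rintro x ⟨a, s, hs, hx⟩ y ⟨b, t, ht, hy⟩ z ⟨hxz, hzy⟩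
    refine ⟨a * t ^ 2 + b * s ^ 2, s * t,
      fun h => (Ideal.IsPrime.mem_or_mem inferInstance h).elim hs ht, ?_⟩
    simp only [map_add, map_mul, map_pow]
    have h1 := mul_le_mul_of_nonneg_right hx (sq_nonneg (α.ev t))
    have h2 := mul_le_mul_of_nonneg_right hy (sq_nonneg (α.ev s))
    have h0 : |z| ≤ |x| + |y| := by
      rcases abs_cases x with hx | hx <;> rcases abs_cases y with hy | hy <;>
        rcases abs_cases z with hz | hz <;> linarith
    have h3 := mul_le_mul_of_nonneg_right h0 (sq_nonneg (α.ev s * α.ev t))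
    linarith
  · refine ⟨a ^ 2 + 1, 1, fun h1 => (inferInstance : β.supp.IsPrime).ne_top
        ((Ideal.eq_top_iff_one _).2 h1), ?_⟩
    simp only [map_add, map_pow, map_one]
    rcases abs_cases (α.ev a) with hx | hx <;> nlinarith [sq_nonneg (α.ev a - 1), sq_nonneg (α.ev a + 1)]
  · have h0 : α.ev a ≠ 0 := by
      rw [Ne, ev_eq_zero]
      exact fun h' => ha (mem_supp.2 ⟨h _ (mem_supp.1 h').1, h _ (mem_supp.1 h').2⟩)
    refine ⟨h0, a ^ 2 + 1, a, ha, ?_⟩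
    have : |(α.ev a)⁻¹| * α.ev a ^ 2 = |α.ev a| := by
      rw [abs_inv, ← sq_abs, pow_two, inv_mul_cancel_left₀ (abs_ne_zero.2 h0)]
    rw [this]
    simp only [map_add, map_pow, map_one]
    rcases abs_cases (α.ev a) with hx | hx <;> nlinarith [sq_nonneg (α.ev a - 1), sq_nonneg (α.ev a + 1)]
  · rintro ⟨h0, b, s, hs, hb⟩ ha
    have hle : α.ev s ^ 2 ≤ α.ev b * |α.ev a| := by
      have := mul_le_mul_of_nonneg_right hb (abs_nonneg (α.ev a))
      rwa [mul_right_comm, abs_inv, inv_mul_cancel₀ (abs_ne_zero.2 h0), one_mul] at this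
    have hex : ∃ a' ∈ β.supp, |α.ev a| = α.ev a' := by
      rcases abs_choice (α.ev a) with h | h
      · exact ⟨a, ha, h⟩
      · exact ⟨-a, neg_mem ha, by rw [h, map_neg]⟩
    obtain ⟨a', ha', he⟩ := hex
    rw [he, ← map_mul, ← map_pow, ← sub_nonneg, ← map_sub, ev_nonneg] at hle
    have h1 : -(s ^ 2) ∈ β := by
      have : -(s ^ 2) = (b * a' - s ^ 2) + -(b * a') := by ring
      rw [this]
      exact add_mem (h _ hle) (mem_supp.1 (β.supp.mul_mem_left b ha')).2
    exact hs (Ideal.IsPrime.mem_of_pow_mem inferInstance 2 (mem_supp.2 ⟨β.sq_mem s, h1⟩))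

/-- The largest convex subring in the definition of `C_{βα}` exists. -/
theorem isGreatest_convexSubring (h : α ⤳ β) :
    IsGreatest {C | IsConvexFor α β C} (convexSubring α β) := by
  have hne : {C | IsConvexFor α β C}.Nonempty := exists_isConvexFor h
  have hdir : DirectedOn (· ≤ ·) {C | IsConvexFor α β C} := by
    intro C hC D hD
    by_cases hle : C ≤ D
    · exact ⟨D, hD, hle, le_rfl⟩
    · refine ⟨C, hC, le_rfl, fun y hy => ?_⟩
      obtain ⟨x, hxC, hxD⟩ := SetLike.not_le_iff_exists.1 hle
      have hC' := hC.ordConnected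
      have hD' := hD.ordConnected
      have habs : ∀ {E : Subring α.rho} {z : α.rho}, z ∈ E → |z| ∈ E := by
        intro E z hz
        rcases abs_choice z with h | h <;> rw [h]
        · exact hz
        · exact neg_mem hz
      rcases le_total |y| |x| with hyx | hyx
      · exact hC'.out (neg_mem (habs hxC)) (habs hxC) (abs_le.1 hyx)
      · exact absurd (hD'.out (neg_mem (habs hy)) (habs hy) (abs_le.1 hyx)) hxD
  have hmem : ∀ {x}, x ∈ convexSubring α β ↔ ∃ C ∈ {C | IsConvexFor α β C}, x ∈ C :=
    Subring.mem_sSup_of_directedOn hne hdir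
  refine ⟨isConvexFor_iff.2 ⟨⟨?_⟩, fun a => ?_, fun a => ⟨fun ha => ?_, ?_⟩⟩,
    fun C hC => le_sSup hC⟩
  · intro x hx y hy z hz
    obtain ⟨C, hC, hxC⟩ := hmem.1 hx
    obtain ⟨D, hD, hyD⟩ := hmem.1 hy
    obtain ⟨E, hE, hCE, hDE⟩ := hdir C hC D hD
    exact hmem.2 ⟨E, hE, hE.ordConnected.out (hCE hxC) (hDE hyD) hz⟩
  · obtain ⟨C, hC⟩ := hne
    exact hmem.2 ⟨C, hC, hC.ev_mem a⟩
  · obtain ⟨C, hC⟩ := hne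
    have := ((isConvexFor_iff.1 hC).2.2 a).1 ha
    exact ⟨this.1, hmem.2 ⟨C, hC, this.2⟩⟩
  · rintro ⟨h0, ha⟩
    obtain ⟨C, hC, haC⟩ := hmem.1 ha
    exact ((isConvexFor_iff.1 hC).2.2 a).2 ⟨h0, haC⟩

/-- `C_{βα}` as a valuation ring of `ρ(α)`; in particular it is a local ring. -/
noncomputable def specRing (h : α ⤳ β) : ValuationSubring α.rho :=
  { convexSubring α β with
    mem_or_inv_mem' := mem_or_inv_mem (isGreatest_convexSubring h).1.ordConnected }

/-- The homomorphism `A → C_{βα}` through which `ρ_α` factors. -/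
noncomputable def toSpecRing (h : α ⤳ β) : A →+* specRing h :=
  α.ev.codRestrict (specRing h) (isGreatest_convexSubring h).1.ev_mem

/-- `ρ_{βα} = C_{βα} / m_{βα}`. -/
abbrev specField (h : α ⤳ β) : Type u := IsLocalRing.ResidueField (specRing h)

/-- The projection `π_{βα} : C_{βα} → ρ_{βα}`. -/
noncomputable abbrev specProj (h : α ⤳ β) : specRing h →+* specField h :=
  IsLocalRing.residue (specRing h)

/-- `ι : ρ(β) → ρ_{βα}` is the comparison homomorphism: `ι ∘ ρ_β` is the composition
`A → C_{βα} → ρ_{βα}`. (This determines `ι`, as `ρ(β)` is a real closure of `κ(β)` and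
`ρ_{βα}` is real closed.) -/
def IsComparison (h : α ⤳ β) (ι : β.rho →+* specField h) : Prop :=
  ι.comp β.ev = (specProj h).comp (toSpecRing h)

end Convex

/-! ### Sections -/

section Sections

variable {A : Type u} [CommRing A] {K : Set (Sper A)}

/-- Compatible sections: for every specialization `β` of `α` in `K`, the value `σ(α)` lies in
`C_{βα}`, and `π_{βα}(σ(α)) = ι(σ(β))` in `ρ_{βα}`. -/
def IsCompatible (σ : ∀ α : K, α.1.rho) : Prop :=
  ∀ (α β : K) (h : α.1 ⤳ β.1), ∃ hσ : σ α ∈ specRing h,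
    ∃ ι : β.1.rho →+* specField h, IsComparison h ι ∧ specProj h ⟨σ α, hσ⟩ = ι (σ β)

open Polynomial

/-- The projection `π : Sper A[t] → Sper A` induced by `A → A[t]`. -/
noncomputable def proj : Sper A[X] → Sper A := comap C

/-- An element `r ∈ ρ(α)` regarded as the point of `Sper A[t]` at which `t` takes the value `r`:
the inverse image of the order of `ρ(α)` under `A[t] → ρ(α)`, `p ↦ p(r)`. -/
noncomputable def sectionPoint (α : Sper A) (r : α.rho) : Sper A[X] :=
  comap (eval₂RingHom α.ev r) α.rhoPoint

theorem proj_sectionPoint (α : Sper A) (r : α.rho) : proj (sectionPoint α r) = α := by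
  refine SetLike.ext fun a => ?_
  simp [proj, sectionPoint, ev_nonneg]

end Sections

end Sper

/-! Write r = σ(α), s = σ(β), with C = C_{βα} and its projection π. Everything rests on comparing
the signs of p(r) and p(s) for p in A[t].

Suppose π(r) = ι(s). Then π(p(r)) = ι(p(s)) for every p, so p(s) > 0 forces p(r) > 0, and s is a
specialization of r. For uniqueness, let γ be a specialization of r over β. It contains every p with
p(s) > 0. If p(s) = 0, then p(r) lies in the maximal ideal of C, and since C is the largest
admissible ring, some even power of p(r) is bounded by b(α) with b in supp β
(`exists_pow_le_of_specProj_eq_zero`). This inequality passes to γ and puts p in supp γ. Hence γ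
contains the point s, and the two agree because s is algebraic over κ(β), which makes the point
closed in its fibre (`eq_sectionPoint_of_le`).

Conversely, let s be the unique specialization of r over β. As s is algebraic over κ(β), it
satisfies a bound (bs)² < a with a, b in A and b outside supp β. The bound must hold for r as well,
so r lies in C. The residue field of C is real closed, so π(r) defines a point of Sper A[t]; this
point is a specialization of r over β, hence equals s. Thus A[t] → ρ(β) and A[t] → ρ_{βα} induce the
same ordering, and the extension theorem for real closures (`IsRealClosed.exists_ringHom_comp_eq`)
yields ι with ι(s) = π(r).

The extension theorem is derived from the algebraic definition of real closed fields: irreducible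
polynomials have degree at most two, which gives the intermediate value theorem and Rolle's theorem,
and these allow roots to be matched by the cuts they define. -/

section

open Polynomial

namespace IsRealClosed

/-! ### Irreducible polynomials over a real closed field -/

section FTA

variable {R : Type*} [Field R] [IsRealClosed R]

/-- The half-angle formulas: with s = √(a² + b²), take c² = (s + a)/2 and d² = (s − a)/2. This
determines 2cd up to sign, and the sign of d is adjusted to obtain b. -/
theorem exists_sq_eq_of_sq_eq_neg_one [LinearOrder R] [IsStrictOrderedRing R]
    {K : Type*} [Field K] [Algebra R K] {i : K} (hi : i ^ 2 = -1) (a b : R) :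
    ∃ c d : R, (algebraMap R K c + algebraMap R K d * i) ^ 2 =
      algebraMap R K a + algebraMap R K b * i := by
  obtain ⟨s, hs0, hs⟩ : ∃ s : R, 0 ≤ s ∧ s ^ 2 = a ^ 2 + b ^ 2 := by
    obtain ⟨s, hs⟩ := nonneg_iff_isSquare.1 (by positivity : 0 ≤ a ^ 2 + b ^ 2)
    exact ⟨|s|, abs_nonneg s, by rw [sq_abs, hs, pow_two]⟩
  obtain ⟨h1, h2⟩ : -s ≤ a ∧ a ≤ s := abs_le.1 (abs_le_of_sq_le_sq (by nlinarith [sq_nonneg b]) hs0)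
  obtain ⟨c, hc⟩ := nonneg_iff_isSquare.1 (by linarith : 0 ≤ (s + a) / 2)
  obtain ⟨d, hd⟩ := nonneg_iff_isSquare.1 (by linarith : 0 ≤ (s - a) / 2)
  have hcd : (2 * c * d) ^ 2 = b ^ 2 := by
    have : (2 * c * d) ^ 2 = 4 * (c * c) * (d * d) := by ring
    rw [this, ← hc, ← hd]; linear_combination hs
  have hsub : c ^ 2 - d ^ 2 = a := by rw [pow_two, pow_two, ← hc, ← hd]; ring
  have key : ∀ d : R, c ^ 2 - d ^ 2 = a → 2 * c * d = b →
      (algebraMap R K c + algebraMap R K d * i) ^ 2 = algebraMap R K a + algebraMap R K b * i := by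
    intro d h h'
    rw [← h, ← h']
    simp only [map_sub, map_pow, map_mul, map_ofNat]
    linear_combination (algebraMap R K d) ^ 2 * hi
  rcases sq_eq_sq_iff_eq_or_eq_neg.1 hcd with h | h
  · exact ⟨c, d, key d hsub h⟩
  · exact ⟨c, -d, key _ (by simpa using hsub) (by linear_combination -h)⟩

theorem natDegree_eq_one_of_odd {f : R[X]} (hf : Irreducible f) (hodd : Odd f.natDegree) :
    f.natDegree = 1 := by
  obtain ⟨x, hx⟩ := exists_isRoot_of_odd_natDegree hodd
  exact natDegree_eq_of_degree_eq_some (degree_eq_one_of_irreducible_of_root hf hx)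

theorem finrank_eq_one_of_odd [CharZero R] {K : Type*} [Field K] [Algebra R K] [FiniteDimensional R K]
    (hodd : Odd (Module.finrank R K)) : Module.finrank R K = 1 := by
  obtain ⟨x, hx⟩ := Field.exists_primitive_element R K
  rw [(Field.primitive_element_iff_minpoly_natDegree_eq R x).1 hx |>.symm] at hodd ⊢
  exact natDegree_eq_one_of_odd (minpoly.irreducible (Algebra.IsIntegral.isIntegral x)) hodd

/-- A field of characteristic zero in which every element is a square has no quadratic extension. -/
theorem finrank_ne_two_of_isSquare {M K : Type*} [Field M] [CharZero M] [Field K] [Algebra M K]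
    (hM : ∀ x : M, IsSquare x) : Module.finrank M K ≠ 2 := by
  intro h
  have : FiniteDimensional M K := .of_finrank_pos (by omega)
  obtain ⟨x, hx⟩ := Field.exists_primitive_element M K
  have hdeg := (Field.primitive_element_iff_minpoly_natDegree_eq M x).1 hx
  have hint : IsIntegral M x := Algebra.IsIntegral.isIntegral x
  set p := minpoly M x
  have hp : p.Monic := minpoly.monic hint
  rw [h] at hdeg
  obtain ⟨s, hs⟩ := hM (p.coeff 1 ^ 2 - 4 * p.coeff 0)
  have hroot : p.IsRoot ((-p.coeff 1 + s) / 2) := by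
    have h2 : p.coeff 2 = 1 := by rw [← hdeg]; exact hp
    rw [IsRoot.def, eval_eq_sum_range, hdeg]
    simp only [Finset.sum_range_succ, Finset.sum_range_zero, h2]
    field_simp
    linear_combination -hs
  have := natDegree_eq_of_degree_eq_some
    (degree_eq_one_of_irreducible_of_root (minpoly.irreducible hint) hroot)
  exact absurd (hdeg.symm.trans this) (by norm_num)

/-- Artin's proof of the fundamental theorem of algebra. In the splitting field N of f·(X² + 1), the
fixed field of a Sylow 2-subgroup has odd degree over R, hence is R, and the Galois group is a
2-group. Since every element of M = R(i) is a square, M has no quadratic extension, so N = M. -/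
theorem natDegree_le_two_of_irreducible [LinearOrder R] [IsStrictOrderedRing R]
    {f : R[X]} (hf : Irreducible f) : f.natDegree ≤ 2 := by
  let N := (f * (X ^ 2 + 1)).SplittingField
  have hsplit : ((f * (X ^ 2 + 1)).map (algebraMap R N)).Splits := SplittingField.splits _
  have hmonic : (X ^ 2 + 1 : R[X]).Monic := by monicity!
  have hdeg : (X ^ 2 + 1 : R[X]).natDegree = 2 := by compute_degree!
  have hF0 : (f * (X ^ 2 + 1)).map (algebraMap R N) ≠ 0 :=
    (Polynomial.map_ne_zero_iff (algebraMap R N).injective).2 (mul_ne_zero hf.ne_zero hmonic.ne_zero)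
  have hnormal : Normal R N := Normal.of_isSplittingField (f * (X ^ 2 + 1))
  have hG : IsGalois R N := {}
  rw [Polynomial.map_mul] at hsplit hF0
  obtain ⟨x, hx⟩ := (hsplit.of_dvd hF0 (dvd_mul_right _ _)).exists_eval_eq_zero
    (by rw [degree_map]; exact hf.degree_pos.ne')
  obtain ⟨i, hi⟩ := (hsplit.of_dvd hF0 (dvd_mul_left _ _)).exists_eval_eq_zero
    (by rw [degree_map, degree_eq_natDegree hmonic.ne_zero, hdeg]; norm_num)
  rw [eval_map_algebraMap] at hx hi
  have hi2 : i ^ 2 = -1 := by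
    simp only [map_add, map_pow, aeval_X, map_one] at hi
    exact eq_neg_of_add_eq_zero_left hi
  -- the Galois group is a `2`-group
  obtain ⟨m, hm⟩ : ∃ m, Nat.card Gal(N/R) = 2 ^ m := by
    obtain ⟨P⟩ : Nonempty (Sylow 2 Gal(N/R)) := inferInstance
    have h1 := IntermediateField.finrank_fixedField_eq_card (P : Subgroup Gal(N/R))
    have h2 := Module.finrank_mul_finrank R (IntermediateField.fixedField (P : Subgroup Gal(N/R))) N
    have h3 := IsGalois.card_aut_eq_finrank R N
    have h4 := (P : Subgroup Gal(N/R)).index_mul_card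
    have h5 : Module.finrank R (IntermediateField.fixedField (P : Subgroup Gal(N/R))) =
        (P : Subgroup Gal(N/R)).index := by
      rw [h1, ← h3, ← h4] at h2
      exact Nat.eq_of_mul_eq_mul_right Nat.card_pos h2
    have h6 := finrank_eq_one_of_odd (h5 ▸ Nat.odd_iff.2 (Nat.two_dvd_ne_zero.1 P.not_dvd_index))
    obtain ⟨m, hm⟩ := IsPGroup.iff_card.1 P.isPGroup'
    exact ⟨m, by rw [← h4, ← h5, h6, one_mul]; exact hm⟩
  let M : IntermediateField R N := IntermediateField.adjoin R {i}
  have hiint : IsIntegral R i := ⟨_, hmonic, by rwa [← aeval_def]⟩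
  have hsq : ∀ z : M, IsSquare z := by
    rintro ⟨z, hz⟩
    have hz' : z ∈ M.toSubalgebra := hz
    rw [IntermediateField.adjoin_simple_toSubalgebra_of_isAlgebraic hiint.isAlgebraic,
      Algebra.adjoin_singleton_eq_range_aeval] at hz'
    obtain ⟨g, rfl⟩ := hz'
    -- The remainder modulo X² + 1 writes an element of R(i) as a + bi.
    obtain ⟨b, a, hab⟩ := exists_eq_X_add_C_of_natDegree_le_one (p := g %ₘ (X ^ 2 + 1)) (by
      have := natDegree_modByMonic_lt g hmonic (by intro h; rw [h] at hdeg; simp at hdeg)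
      omega)
    have hg : aeval i g = algebraMap R N a + algebraMap R N b * i := by
      have : aeval i g = aeval i (g %ₘ (X ^ 2 + 1)) := by
        rw [modByMonic_eq_sub_mul_div, map_sub, map_mul, hi]; simp
      rw [this, hab]
      simp [add_comm]
    obtain ⟨c, d, hcd⟩ := exists_sq_eq_of_sq_eq_neg_one hi2 a b
    refine ⟨⟨algebraMap R N c + algebraMap R N d * i, add_mem (M.algebraMap_mem _)
      (mul_mem (M.algebraMap_mem _) (IntermediateField.mem_adjoin_simple_self R i))⟩, ?_⟩
    ext
    simp only [MulMemClass.coe_mul]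
    rw [← pow_two, hcd, ← hg]
    rfl
  have hMN : Module.finrank M N = 1 := by
    have h1 := IsGalois.card_aut_eq_finrank R N
    have h2 := IsGalois.card_aut_eq_finrank M N
    have h3 := Module.finrank_mul_finrank R M N
    obtain ⟨l, hl, hl'⟩ := (Nat.dvd_prime_pow Nat.prime_two).1
      (show Module.finrank M N ∣ 2 ^ m by rw [← hm, h1, ← h3]; exact dvd_mul_left _ _)
    rcases l with _ | l
    · simpa using hl'
    exfalso
    -- If [N : M] = 2^(l+1), a subgroup of order 2^l has a fixed field that is quadratic over M.
    obtain ⟨H, hH⟩ := Sylow.exists_subgroup_card_pow_prime (G := Gal(N/M)) 2 (n := l)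
      (by rw [h2, hl']; exact pow_dvd_pow _ (by omega))
    have h4 := IntermediateField.finrank_fixedField_eq_card H
    have h5 := Module.finrank_mul_finrank M (IntermediateField.fixedField H) N
    rw [h4, hH, hl'] at h5
    exact finrank_ne_two_of_isSquare hsq
      (Nat.eq_of_mul_eq_mul_right (by positivity) (h5.trans (pow_succ' 2 l)))
  have hRM : Module.finrank R M ≤ 2 := by
    rw [IntermediateField.adjoin.finrank hiint]
    exact (natDegree_le_of_dvd (minpoly.dvd R i hi) hmonic.ne_zero).trans hdeg.le
  have hRN : Module.finrank R N ≤ 2 := by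
    rwa [← Module.finrank_mul_finrank R M N, hMN, mul_one]
  have hfx : f.natDegree = (minpoly R x).natDegree := by
    rw [← minpoly.eq_of_irreducible hf hx, natDegree_mul_C (by simpa using hf.ne_zero)]
  rw [hfx]
  exact (minpoly.natDegree_le x).trans hRN

end FTA

/-! ### Intermediate values, Rolle's theorem and monotonicity -/

section IVT

variable {R : Type*} [Field R] [LinearOrder R] [IsStrictOrderedRing R] [IsRealClosed R]

/-- An irreducible quadratic has negative discriminant, so completing the square gives 4u·f(x) > 0
for its leading coefficient u and all x. -/
theorem mul_eval_pos_of_natDegree_eq_two {f : R[X]} (hf : Irreducible f) (h2 : f.natDegree = 2)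
    (a b : R) : 0 < f.eval a * f.eval b := by
  have heval : ∀ x, f.eval x = f.coeff 2 * x ^ 2 + f.coeff 1 * x + f.coeff 0 := by
    intro x
    rw [eval_eq_sum_range, h2]
    simp only [Finset.sum_range_succ, Finset.sum_range_zero]
    ring
  have hlead : f.coeff 2 ≠ 0 := by
    rw [← h2]; exact leadingCoeff_ne_zero.2 hf.ne_zero
  set u := f.coeff 2
  set v := f.coeff 1
  set w := f.coeff 0
  have hdisc : v ^ 2 - 4 * u * w < 0 := by
    by_contra! h
    obtain ⟨s, hs⟩ := nonneg_iff_isSquare.1 h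
    have hroot : f.IsRoot ((-v + s) / (2 * u)) := by
      rw [IsRoot.def, heval]
      field_simp
      linear_combination -hs
    have := natDegree_eq_of_degree_eq_some (degree_eq_one_of_irreducible_of_root hf hroot)
    exact absurd (h2.symm.trans this) (by norm_num)
  have hpos : ∀ x, 0 < 4 * u * f.eval x := by
    intro x
    rw [heval]
    nlinarith [sq_nonneg (2 * u * x + v)]
  have h := mul_pos (hpos a) (hpos b)
  have hu : 0 < 16 * u ^ 2 := by positivity
  have : 4 * u * f.eval a * (4 * u * f.eval b) = 16 * u ^ 2 * (f.eval a * f.eval b) := by ring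
  rw [this] at h
  exact (mul_pos_iff_of_pos_left hu).1 h

/-- The intermediate value theorem for polynomials over a real closed field. -/
theorem exists_eval_eq_zero_of_mul_neg {a b : R} (hab : a < b) (f : R[X])
    (hf : f.eval a * f.eval b < 0) : ∃ c ∈ Set.Ioo a b, f.eval c = 0 := by
  -- If f changes sign, so does one of its irreducible factors. That factor cannot be quadratic, so
  -- it is linear and its root lies between a and b.
  induction f using WfDvdMonoid.induction_on_irreducible with
  | zero => simp at hf
  | unit u hu =>
    obtain ⟨r, -, rfl⟩ := Polynomial.isUnit_iff.1 hu
    simp only [eval_C] at hf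
    exact absurd hf (not_lt.2 (mul_self_nonneg r))
  | mul q p hq hp ih =>
    rw [eval_mul, eval_mul] at hf
    by_cases hpab : p.eval a * p.eval b < 0
    · have h2 := natDegree_le_two_of_irreducible hp
      have h0 := hp.natDegree_pos
      rcases (show p.natDegree = 1 ∨ p.natDegree = 2 by omega) with h | h
      · have heval : ∀ x, p.eval x = p.coeff 1 * x + p.coeff 0 := by
          intro x
          rw [eval_eq_sum_range, h]
          simp only [Finset.sum_range_succ, Finset.sum_range_zero]
          ring
        have hlead : p.coeff 1 ≠ 0 := by
          rw [← h]; exact leadingCoeff_ne_zero.2 hp.ne_zero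
        set u := p.coeff 1
        set v := p.coeff 0
        have h3 : u ^ 2 * ((a - -v / u) * (b - -v / u)) < 0 := by
          rw [heval, heval] at hpab
          have : u ^ 2 * ((a - -v / u) * (b - -v / u)) = (u * a + v) * (u * b + v) := by
            field_simp; ring
          rwa [this]
        have h4 : (a - -v / u) * (b - -v / u) < 0 := by
          by_contra! h5
          exact absurd h3 (not_lt.2 (mul_nonneg (sq_nonneg u) h5))
        refine ⟨-v / u, ?_, ?_⟩
        · rcases mul_neg_iff.1 h4 with ⟨h5, h6⟩ | ⟨h5, h6⟩
          · linarith
          · exact ⟨by linarith, by linarith⟩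
        · rw [eval_mul, heval]
          field_simp
          simp
      · exact absurd hpab (not_lt.2 (mul_eval_pos_of_natDegree_eq_two hp h a b).le)
    · obtain ⟨c, hc, h⟩ := ih (by
        by_contra! h
        have := mul_nonneg (not_lt.1 hpab) h
        linarith)
      exact ⟨c, hc, by simp [h]⟩

/-- Between consecutive roots a < b', write f = (X − a)^(m+1) (X − b')^(k+1) h, where h has constant
sign on [a, b']. Then f' = (X − a)^m (X − b')^k G, and the explicit G takes values of opposite signs
at a and b'. -/
theorem exists_isRoot_derivative_of_isRoot {a b : R} (hab : a < b) {f : R[X]}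
    (ha : f.eval a = 0) (hb : f.eval b = 0) : ∃ c ∈ Set.Ioo a b, f.derivative.eval c = 0 := by
  classical
  by_cases hf : f = 0
  · exact ⟨(a + b) / 2, ⟨by linarith, by linarith⟩, by simp [hf]⟩
  -- pass to consecutive roots
  obtain ⟨b', hab', hbb', hb', hno⟩ : ∃ b', a < b' ∧ b' ≤ b ∧ f.eval b' = 0 ∧
      ∀ c ∈ Set.Ioo a b', f.eval c ≠ 0 := by
    have hne : (f.roots.toFinset.filter (fun x => a < x)).Nonempty :=
      ⟨b, by simp [hf, hb, hab]⟩
    have hmin := Finset.min'_mem _ hne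
    simp only [Finset.mem_filter, Multiset.mem_toFinset, mem_roots hf, IsRoot.def] at hmin
    refine ⟨_, hmin.2, Finset.min'_le _ _ (by simp [hf, hb, hab]), hmin.1, fun c hc h => ?_⟩
    exact absurd (Finset.min'_le _ c (by simp [hf, h, hc.1])) (not_le.2 hc.2)
  obtain ⟨g, hg, hga⟩ := exists_eq_pow_rootMultiplicity_mul_and_not_dvd f hf a
  have hm : 0 < f.rootMultiplicity a := (rootMultiplicity_pos hf).2 ha
  obtain ⟨m, hm⟩ := Nat.exists_eq_succ_of_ne_zero hm.ne'
  rw [hm] at hg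
  have hg0 : g ≠ 0 := by rintro rfl; simp at hga
  have hgb : g.eval b' = 0 := by
    rw [hg, eval_mul, eval_pow] at hb'
    exact (mul_eq_zero.1 hb').resolve_left (pow_ne_zero _ (by simpa [sub_eq_zero] using hab'.ne'))
  obtain ⟨h, hh, hhb⟩ := exists_eq_pow_rootMultiplicity_mul_and_not_dvd g hg0 b'
  have hk : 0 < g.rootMultiplicity b' := (rootMultiplicity_pos hg0).2 hgb
  obtain ⟨k, hk⟩ := Nat.exists_eq_succ_of_ne_zero hk.ne'
  rw [hk] at hh
  rw [dvd_iff_isRoot, IsRoot.def] at hga hhb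
  have hha : h.eval a ≠ 0 := by
    intro h0
    apply hga
    rw [hh, eval_mul, h0, mul_zero]
  have hpos : 0 < h.eval a * h.eval b' := by
    refine lt_of_le_of_ne ?_ (mul_ne_zero hha hhb).symm
    by_contra! hneg
    obtain ⟨c, hc, hc0⟩ := exists_eval_eq_zero_of_mul_neg hab' h hneg
    exact hno c hc (by rw [hg, hh, eval_mul, eval_mul, hc0, mul_zero, mul_zero])
  let G : R[X] := ((m + 1 : ℕ) : R[X]) * (X - C b') * h + ((k + 1 : ℕ) : R[X]) * (X - C a) * h +
    (X - C a) * (X - C b') * derivative h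
  have hG : derivative f = (X - C a) ^ m * (X - C b') ^ k * G := by
    rw [hg, hh]
    simp only [derivative_mul, derivative_X_sub_C_pow, Nat.succ_eq_add_one, Nat.add_sub_cancel, G,
      C_eq_natCast]
    ring
  obtain ⟨c, hc, hc0⟩ := exists_eval_eq_zero_of_mul_neg hab' G (by
    have : G.eval a * G.eval b' =
        -(((m + 1 : ℕ) : R) * ((k + 1 : ℕ) : R) * (b' - a) ^ 2 * (h.eval a * h.eval b')) := by
      simp only [G, eval_add, eval_mul, eval_sub, eval_X, eval_C, eval_natCast]
      ring
    rw [this, neg_lt_zero]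
    have : 0 < b' - a := sub_pos.2 hab'
    positivity)
  exact ⟨c, ⟨hc.1, hc.2.trans_le hbb'⟩, by rw [hG, eval_mul, hc0, mul_zero]⟩

/-- The mean value theorem, obtained by applying Rolle's theorem to f minus its chord of slope s. -/
theorem strictMonoOn_of_derivative_pos {l u : R} {f : R[X]}
    (hf : ∀ x ∈ Set.Ioo l u, 0 < f.derivative.eval x) :
    StrictMonoOn (fun x => f.eval x) (Set.Icc l u) := by
  intro x hx y hy hxy
  by_contra! h
  set s := (f.eval y - f.eval x) / (y - x)
  have hyx : 0 < y - x := sub_pos.2 hxy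
  have hs : s * (y - x) = f.eval y - f.eval x := div_mul_cancel₀ _ hyx.ne'
  obtain ⟨c, hc, hc0⟩ := exists_isRoot_derivative_of_isRoot hxy
    (f := f - C (f.eval x) - C s * (X - C x)) (by simp) (by simp [hs])
  have h1 : f.derivative.eval c = s := by
    simpa [sub_eq_zero] using hc0
  have h2 := hf c ⟨hx.1.trans_lt hc.1, hc.2.trans_le hy.2⟩
  have h3 : s ≤ 0 := div_nonpos_of_nonpos_of_nonneg (by linarith) hyx.le
  linarith

open SignType in
theorem sign_eval_eq_of_forall_ne_zero {f : R[X]} (s : Set R) [s.OrdConnected]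
    (hf : ∀ x ∈ s, f.eval x ≠ 0) {a b : R} (ha : a ∈ s) (hb : b ∈ s) :
    sign (f.eval a) = sign (f.eval b) := by
  wlog hab : a < b generalizing a b
  · rcases eq_or_lt_of_not_gt hab with h | h
    · rw [h]
    · exact (this hb ha h).symm
  have : ¬ f.eval a * f.eval b < 0 := fun h => by
    obtain ⟨c, hc, hc0⟩ := exists_eval_eq_zero_of_mul_neg hab f h
    exact hf c (Set.OrdConnected.out ‹_› ha hb ⟨hc.1.le, hc.2.le⟩) hc0
  rcases lt_or_gt_of_ne (hf a ha) with h1 | h1 <;> rcases lt_or_gt_of_ne (hf b hb) with h2 | h2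
  · rw [sign_neg h1, sign_neg h2]
  · exact absurd (mul_neg_of_neg_of_pos h1 h2) this
  · exact absurd (mul_neg_of_pos_of_neg h1 h2) this
  · rw [sign_pos h1, sign_pos h2]

end IVT

end IsRealClosed

/-- A Cauchy-type bound for the roots of a polynomial. -/
theorem Polynomial.abs_map_leadingCoeff_mul_abs_le {B R : Type*} [CommRing B] [Field R]
    [LinearOrder R] [IsStrictOrderedRing R] (f : B →+* R) {p : B[X]} {x : R}
    (hx : p.eval₂ f x = 0) :
    |f p.leadingCoeff| * |x| ≤ ∑ i ∈ Finset.range (p.natDegree + 1), |f (p.coeff i)| := by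
  rcases le_total |x| 1 with h1 | h1
  -- The sum on the right includes the leading term precisely to cover the case |x| ≤ 1.
  · refine (mul_le_of_le_one_right (abs_nonneg _) h1).trans ?_
    exact Finset.single_le_sum (f := fun i => |f (p.coeff i)|) (fun i _ => abs_nonneg _)
      (Finset.self_mem_range_succ _)
  rw [Finset.sum_range_succ]
  refine le_add_of_le_of_nonneg ?_ (abs_nonneg _)
  rw [eval₂_eq_sum_range, Finset.sum_range_succ, add_comm] at hx
  set n := p.natDegree
  have hx0 : 0 < |x| := by linarith
  rcases Nat.eq_zero_or_pos n with hn | hn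
  · rw [hn] at hx ⊢
    have : p.leadingCoeff = p.coeff 0 := by rw [← hn]; rfl
    rw [this]
    simp at hx ⊢
    simp [hx]
  -- For |x| ≥ 1 every lower power of |x| is at most |x|^(n−1), which is then cancelled.
  have h2 : |f p.leadingCoeff| * |x| ^ n ≤
      (∑ i ∈ Finset.range n, |f (p.coeff i)|) * |x| ^ (n - 1) := by
    have hl : p.leadingCoeff = p.coeff n := rfl
    have : |f p.leadingCoeff| * |x| ^ n = |∑ i ∈ Finset.range n, f (p.coeff i) * x ^ i| := by
      rw [← abs_pow, ← abs_mul, ← abs_neg, hl, ← eq_neg_of_add_eq_zero_right hx]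
    rw [this, Finset.sum_mul]
    refine (Finset.abs_sum_le_sum_abs _ _).trans (Finset.sum_le_sum fun i hi => ?_)
    rw [abs_mul, abs_pow]
    exact mul_le_mul_of_nonneg_left (pow_le_pow_right₀ h1 (by
      have := Finset.mem_range.1 hi; omega)) (abs_nonneg _)
  rw [show n = n - 1 + 1 by omega, pow_succ', ← mul_assoc] at h2
  exact le_of_mul_le_mul_right (by simpa [show n - 1 + 1 = n by omega] using h2) (pow_pos hx0 _)

/-! ### Cuts, and the extension of ordered embeddings to real closures -/

namespace IsRealClosed

section Cut

theorem sign_map_eq {E R : Type*} [Field E] [LinearOrder E] [Field R] [LinearOrder R]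
    {r : E →+* R} (hr : StrictMono r) (x : E) : SignType.sign (r x) = SignType.sign x := by
  rcases lt_trichotomy x 0 with h | rfl | h
  · rw [sign_neg h, sign_neg (by simpa using hr h)]
  · simp
  · rw [sign_pos h, sign_pos (by simpa using hr h)]

variable {E : Type*} {R S : Type u} [Field E] [LinearOrder E] [IsStrictOrderedRing E]
  [Field R] [LinearOrder R] [IsStrictOrderedRing R] [IsRealClosed R]
  [Field S] [LinearOrder S] [IsStrictOrderedRing S] [IsRealClosed S]
  {r : E →+* R} {s : E →+* S}

/-- The sign of a polynomial whose degree is less than `n` at a point depends only on the cut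
of this point, if all the roots of such polynomials are in the base field. -/
theorem sign_eval₂_eq_of_cut (hr : StrictMono r) (hs : StrictMono s) {n : ℕ}
    (hR : ∀ g : E[X], g ≠ 0 → g.natDegree < n → ∀ x, g.eval₂ r x = 0 → x ∈ r.range)
    (hS : ∀ g : E[X], g ≠ 0 → g.natDegree < n → ∀ x, g.eval₂ s x = 0 → x ∈ s.range)
    {a : R} {b : S} (hab : ∀ e, SignType.sign (a - r e) = SignType.sign (b - s e))
    (g : E[X]) (hg : g.natDegree < n) :
    SignType.sign (g.eval₂ r a) = SignType.sign (g.eval₂ s b) := by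
  induction hd : g.natDegree using Nat.strong_induction_on generalizing g with
  | h d ih =>
  by_cases hg0 : g = 0
  · simp [hg0]
  -- A root in E splits off a linear factor, whose sign is given by the cut. Without a root in E
  -- there is none in R or S either, so the sign is constant on each field and equals that of g(0).
  by_cases hroot : ∃ e, g.IsRoot e
  · obtain ⟨e, he⟩ := hroot
    obtain ⟨h, rfl⟩ := dvd_iff_isRoot.2 he
    have hh0 : h ≠ 0 := right_ne_zero_of_mul hg0
    have hdeg : ((X - C e) * h).natDegree = h.natDegree + 1 := by
      rw [natDegree_mul (X_sub_C_ne_zero e) hh0, natDegree_X_sub_C, add_comm]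
    rw [eval₂_mul, eval₂_mul, sign_mul, sign_mul, ih h.natDegree (by omega) h (by omega) rfl]
    simp [hab]
  · have hne : ∀ {F : Type u} [Field F] {φ : E →+* F}, (∀ x, g.eval₂ φ x = 0 → x ∈ φ.range) →
        ∀ x, (g.map φ).eval x ≠ 0 := by
      intro F _ φ h x hx
      rw [eval_map] at hx
      obtain ⟨e, rfl⟩ := h x hx
      rw [eval₂_hom, map_eq_zero] at hx
      exact hroot ⟨e, hx⟩
    have h1 := sign_eval_eq_of_forall_ne_zero Set.univ (fun x _ => hne (hR g hg0 hg) x)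
      (Set.mem_univ a) (Set.mem_univ (r 0))
    have h2 := sign_eval_eq_of_forall_ne_zero Set.univ (fun x _ => hne (hS g hg0 hg) x)
      (Set.mem_univ b) (Set.mem_univ (s 0))
    rw [eval_map, eval_map, eval₂_hom, sign_map_eq ‹_›] at h1 h2
    rw [h1, h2]

/-- As f' has degree less than n, all its roots lie in E. Hence a lies between some l < u in E with
no root of f' between them, and f is strictly monotone on the corresponding intervals of R and S.
The signs of f(l) and f(u) are read in E, so f also has a root b between l and u in S. -/
theorem exists_root_same_cut (hr : StrictMono r) (hs : StrictMono s) {n : ℕ}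
    (hR : ∀ g : E[X], g ≠ 0 → g.natDegree < n → ∀ x, g.eval₂ r x = 0 → x ∈ r.range)
    (hS : ∀ g : E[X], g ≠ 0 → g.natDegree < n → ∀ x, g.eval₂ s x = 0 → x ∈ s.range)
    {f : E[X]} (hf0 : f ≠ 0) (hfn : f.natDegree = n) {a : R} (ha : f.eval₂ r a = 0)
    (har : a ∉ r.range) :
    ∃ b, f.eval₂ s b = 0 ∧ b ∉ s.range ∧ ∀ e, SignType.sign (a - r e) = SignType.sign (b - s e) := by
  classical
  have hn : 0 < n := by
    rw [← hfn, Nat.pos_iff_ne_zero]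
    intro h
    rw [eq_C_of_natDegree_eq_zero h, eval₂_C, map_eq_zero] at ha
    exact hf0 (by rw [eq_C_of_natDegree_eq_zero h, ha, C_0])
  have hane : ∀ e, r e ≠ a := fun e he => har ⟨e, he⟩
  have hf' : derivative f ≠ 0 := by
    intro h
    have := derivative_eq_zero.1 h
    omega
  have hdf : (derivative f).natDegree < n := hfn ▸ natDegree_derivative_lt (by omega)
  -- bounds for `a` in the base field
  obtain ⟨M, hM⟩ : ∃ M : E, |a| < r M := by
    have h := abs_map_leadingCoeff_mul_abs_le r ha
    have hl : 0 < |f.leadingCoeff| := abs_pos.2 (leadingCoeff_ne_zero.2 hf0)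
    have habs : ∀ e, |r e| = r |e| := fun e => by
      rcases abs_cases e with ⟨h, h'⟩ | ⟨h, h'⟩
      · rw [h, abs_of_nonneg (by simpa using hr.monotone h')]
      · rw [h, abs_of_neg (by simpa using hr h'), map_neg]
    simp only [habs, ← map_sum] at h
    refine ⟨(∑ i ∈ Finset.range (f.natDegree + 1), |f.coeff i|) / |f.leadingCoeff| + 1, ?_⟩
    rw [map_add, map_div₀, map_one]
    have hl' : 0 < r |f.leadingCoeff| := by simpa using hr hl
    have : |a| ≤ r (∑ i ∈ Finset.range (f.natDegree + 1), |f.coeff i|) / r |f.leadingCoeff| := by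
      rw [le_div_iff₀ hl', mul_comm]; exact h
    linarith
  obtain ⟨hM1, hM2⟩ := abs_lt.1 hM
  -- an interval that contains `a` and no root of the derivative
  obtain ⟨l, hla, hl⟩ : ∃ l, r l < a ∧ ∀ e, (derivative f).IsRoot e → r e < a → e ≤ l := by
    let Z := insert (-M) ((derivative f).roots.toFinset.filter fun e => r e < a)
    have hZ : Z.Nonempty := ⟨-M, by simp [Z]⟩
    refine ⟨Z.max' hZ, ?_, fun e he hea => Finset.le_max' _ _ (by
      simp only [Z, Finset.mem_insert, Finset.mem_filter, Multiset.mem_toFinset, mem_roots hf']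
      exact .inr ⟨he, hea⟩)⟩
    have := Finset.max'_mem Z hZ
    simp only [Z, Finset.mem_insert, Finset.mem_filter] at this
    rcases this with h | h
    · simp only [Z]; rw [h, map_neg]; exact hM1
    · exact h.2
  obtain ⟨u, hau, hu⟩ : ∃ u, a < r u ∧ ∀ e, (derivative f).IsRoot e → a < r e → u ≤ e := by
    let Z := insert M ((derivative f).roots.toFinset.filter fun e => a < r e)
    have hZ : Z.Nonempty := ⟨M, by simp [Z]⟩
    refine ⟨Z.min' hZ, ?_, fun e he hea => Finset.min'_le _ _ (by
      simp only [Z, Finset.mem_insert, Finset.mem_filter, Multiset.mem_toFinset, mem_roots hf']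
      exact .inr ⟨he, hea⟩)⟩
    have := Finset.min'_mem Z hZ
    simp only [Z, Finset.mem_insert, Finset.mem_filter] at this
    rcases this with h | h
    · simp only [Z]; rw [h]; exact hM2
    · exact h.2
  have hlu : l < u := hr.lt_iff_lt.1 (hla.trans hau)
  have hnoE : ∀ e, (derivative f).IsRoot e → e ∉ Set.Ioo l u := by
    intro e he hmem
    rcases lt_or_gt_of_ne (hane e) with h | h
    · exact absurd (hl e he h) (not_le.2 hmem.1)
    · exact absurd (hu e he h) (not_le.2 hmem.2)
  have hno : ∀ {F : Type u} [Field F] [LinearOrder F] [IsStrictOrderedRing F] {φ : E →+* F},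
      StrictMono φ → (∀ x, (derivative f).eval₂ φ x = 0 → x ∈ φ.range) →
      ∀ x ∈ Set.Ioo (φ l) (φ u), ((derivative f).map φ).eval x ≠ 0 := by
    intro F _ _ _ φ hφ h x hx hx0
    rw [eval_map] at hx0
    obtain ⟨e, rfl⟩ := h x hx0
    rw [eval₂_hom, map_eq_zero] at hx0
    exact hnoE e hx0 ⟨hφ.lt_iff_lt.1 hx.1, hφ.lt_iff_lt.1 hx.2⟩
  -- we may assume that the derivative is positive in the middle of this interval
  set c := (l + u) / 2
  have hc : c ∈ Set.Ioo l u := ⟨by simp only [c]; linarith, by simp only [c]; linarith⟩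
  wlog hpos : 0 < (derivative f).eval c generalizing f
  · have hneg : (derivative f).eval c < 0 :=
      lt_of_le_of_ne (not_lt.1 hpos) fun h => hnoE c h hc
    obtain ⟨b, hb, hb'⟩ := this (f := -f) (neg_ne_zero.2 hf0) (by rwa [natDegree_neg])
      (by rw [eval₂_neg, ha, neg_zero]) (by rwa [derivative_neg, neg_ne_zero])
      (by rwa [derivative_neg, natDegree_neg])
      (fun e he => hl e (by simpa using he)) (fun e he => hu e (by simpa using he))
      (fun e he => hnoE e (by simpa using he))
      (fun hφ h x hx => by
        have := hno hφ (fun x hx => h x (by simpa using hx)) x hx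
        simpa using this) (by simpa using hneg)
    exact ⟨b, by simpa using hb, hb'⟩
  have hmono : ∀ {F : Type u} [Field F] [LinearOrder F] [IsStrictOrderedRing F] [IsRealClosed F]
      {φ : E →+* F}, StrictMono φ → (∀ x, (derivative f).eval₂ φ x = 0 → x ∈ φ.range) →
      StrictMonoOn (fun x => (f.map φ).eval x) (Set.Icc (φ l) (φ u)) := by
    intro F _ _ _ _ φ hφ h
    refine strictMonoOn_of_derivative_pos fun x hx => ?_
    rw [derivative_map]
    have h1 := sign_eval_eq_of_forall_ne_zero _ (hno hφ h) hx
      (show φ c ∈ _ from ⟨hφ hc.1, hφ hc.2⟩)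
    rw [← sign_eq_one_iff, h1, eval_map, eval₂_hom, sign_eq_one_iff]
    simpa using hφ hpos
  have hmR := hmono hr (hR _ hf' hdf)
  have hmS := hmono hs (hS _ hf' hdf)
  have hlR : r l ∈ Set.Icc (r l) (r u) := ⟨le_rfl, hr.monotone hlu.le⟩
  have huR : r u ∈ Set.Icc (r l) (r u) := ⟨hr.monotone hlu.le, le_rfl⟩
  have haR : a ∈ Set.Icc (r l) (r u) := ⟨hla.le, hau.le⟩
  have hfl : f.eval l < 0 := by
    have := hmR hlR haR hla
    simp only [eval_map, ha, eval₂_hom] at this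
    exact hr.lt_iff_lt.1 (by simpa using this)
  have hfu : 0 < f.eval u := by
    have := hmR haR huR hau
    simp only [eval_map, ha, eval₂_hom] at this
    exact hr.lt_iff_lt.1 (by simpa using this)
  obtain ⟨b, hb, hb0⟩ := exists_eval_eq_zero_of_mul_neg (hs hlu) (f.map s) (by
    rw [eval_map, eval_map, eval₂_hom, eval₂_hom, ← map_mul]
    simpa using hs (mul_neg_of_neg_of_pos hfl hfu))
  have hbS : b ∈ Set.Icc (s l) (s u) := ⟨hb.1.le, hb.2.le⟩
  have hcut : ∀ e, SignType.sign (a - r e) = SignType.sign (b - s e) := by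
    intro e
    by_cases hel : e ≤ l
    · rw [sign_pos (sub_pos.2 ((hr.monotone hel).trans_lt hla)),
        sign_pos (sub_pos.2 ((hs.monotone hel).trans_lt hb.1))]
    by_cases hue : u ≤ e
    · rw [sign_neg (sub_neg.2 (hau.trans_le (hr.monotone hue))),
        sign_neg (sub_neg.2 (hb.2.trans_le (hs.monotone hue)))]
    have heR : r e ∈ Set.Icc (r l) (r u) :=
      ⟨hr.monotone (not_le.1 hel).le, hr.monotone (not_le.1 hue).le⟩
    have heS : s e ∈ Set.Icc (s l) (s u) :=
      ⟨hs.monotone (not_le.1 hel).le, hs.monotone (not_le.1 hue).le⟩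
    -- By monotonicity, the position of e relative to either root is decided by the sign of f(e), an
    -- element of E.
    rcases lt_or_gt_of_ne (hane e) with h | h
    · rw [sign_pos (sub_pos.2 h), eq_comm, sign_eq_one_iff, sub_pos, ← hmS.lt_iff_lt heS hbS]
      have := hmR heR haR h
      simp only [eval_map, ha, eval₂_hom] at this
      simp only [hb0, eval_map, eval₂_hom]
      simpa using hs (hr.lt_iff_lt.1 (by simpa using this) : f.eval e < 0)
    · rw [sign_neg (sub_neg.2 h), eq_comm, sign_eq_neg_one_iff, sub_neg, ← hmS.lt_iff_lt hbS heS]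
      have := hmR haR heR h
      simp only [eval_map, ha, eval₂_hom] at this
      simp only [hb0, eval_map, eval₂_hom]
      simpa using hs (hr.lt_iff_lt.1 (by simpa using this) : 0 < f.eval e)
  refine ⟨b, by rwa [eval_map] at hb0, ?_, hcut⟩
  rintro ⟨e, rfl⟩
  have := hcut e
  rw [sub_self, sign_zero, sign_eq_zero_iff, sub_eq_zero] at this
  exact hane e this.symm

end Cut

end IsRealClosed

/-- Extension of a lift to a simple extension, given a root of the transported minimal polynomial. -/
theorem IntermediateField.Lifts.exists_le_mem_of_eval₂_minpoly {k R S : Type*} [Field k] [Field R]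
    [Field S] [Algebra k R] [Algebra k S] (L : IntermediateField.Lifts k R S) {a : R} {b : S}
    (ha : IsIntegral L.carrier a)
    (hb : (minpoly L.carrier a).eval₂ L.emb.toRingHom b = 0) :
    ∃ L', L ≤ L' ∧ a ∈ L'.carrier ∧ ∀ x : L'.carrier, ∃ g : L.carrier[X],
      g.eval₂ (algebraMap L.carrier R) a = x ∧ g.eval₂ L.emb.toRingHom b = L'.emb x := by
  let : Algebra L.carrier S := L.emb.toRingHom.toAlgebra
  let M := (IntermediateField.adjoin L.carrier {a}).restrictScalars k
  let : Algebra L.carrier M := (IntermediateField.adjoin L.carrier {a}).toSubalgebra.algebra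
  let φ : IntermediateField.adjoin L.carrier {a} →ₐ[L.carrier] S :=
    (IntermediateField.algHomAdjoinIntegralEquiv L.carrier ha).symm
      ⟨b, by
        rw [mem_aroots, and_iff_right (minpoly.ne_zero ha)]
        exact hb⟩
  have hφ : φ (IntermediateField.AdjoinSimple.gen L.carrier a) = b :=
    IntermediateField.algHomAdjoinIntegralEquiv_symm_apply_gen _ _ _
  refine ⟨⟨M, (@algHomEquivSigma k L.carrier M S _ _ _ _ _ _ _ _
      (IsScalarTower.of_algebraMap_eq fun _ ↦ rfl)).symm ⟨L.emb, φ⟩⟩,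
    ⟨fun z hz ↦ algebraMap_mem (IntermediateField.adjoin L.carrier {a}) ⟨z, hz⟩, φ.commutes⟩,
    IntermediateField.mem_adjoin_simple_self L.carrier a, fun x => ?_⟩
  -- Elements of the simple extension are values g(a), and the extended map sends g(a) to g(b). This
  -- description is what later permits checking positivity.
  obtain ⟨x, hx⟩ := x
  have hx' : x ∈ (IntermediateField.adjoin L.carrier {a}).toSubalgebra := hx
  rw [IntermediateField.adjoin_simple_toSubalgebra_of_isAlgebraic ha.isAlgebraic,
    Algebra.adjoin_singleton_eq_range_aeval] at hx'
  obtain ⟨g, rfl⟩ := hx'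
  refine ⟨g, rfl, ?_⟩
  have h1 : aeval (IntermediateField.AdjoinSimple.gen L.carrier a) g = ⟨aeval a g, hx⟩ := by
    ext
    exact (aeval_algebraMap_apply R (IntermediateField.AdjoinSimple.gen L.carrier a) g).symm
  change g.eval₂ L.emb.toRingHom b = φ ⟨aeval a g, hx⟩
  rw [← h1, ← aeval_algHom_apply, hφ]
  rfl

namespace IsRealClosed

/-- The element x only guarantees that some polynomial over E has a root outside E. Taking such a
polynomial f of least degree, with the new root in R or in S, keeps the argument symmetric. The new
root has a partner in the other field with the same cut, so a need not be x. -/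
theorem exists_sign_eval₂_eq {E : Type*} {R S : Type u} [Field E] [LinearOrder E]
    [IsStrictOrderedRing E]
    [Field R] [LinearOrder R] [IsStrictOrderedRing R] [IsRealClosed R]
    [Field S] [LinearOrder S] [IsStrictOrderedRing S] [IsRealClosed S]
    {r : E →+* R} {s : E →+* S} (hr : StrictMono r) (hs : StrictMono s)
    {x : R} (hx : x ∉ r.range) {p : E[X]} (hp : p ≠ 0) (hpx : p.eval₂ r x = 0) :
    ∃ a ∉ r.range, ∃ b, ∀ g : E[X], SignType.sign (g.eval₂ r a) = SignType.sign (g.eval₂ s b) := by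
  classical
  let P : ℕ → Prop := fun n => ∃ f : E[X], f ≠ 0 ∧ f.natDegree = n ∧
    ((∃ x ∉ r.range, f.eval₂ r x = 0) ∨ ∃ x ∉ s.range, f.eval₂ s x = 0)
  have hP : ∃ n, P n := ⟨p.natDegree, p, hp, rfl, .inl ⟨x, hx, hpx⟩⟩
  have hmin : ∀ g : E[X], g ≠ 0 → g.natDegree < Nat.find hP → ¬ P g.natDegree :=
    fun g _ hg => Nat.find_min hP hg
  have hR : ∀ g : E[X], g ≠ 0 → g.natDegree < Nat.find hP →
      ∀ x, g.eval₂ r x = 0 → x ∈ r.range := fun g hg0 hg x hx => by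
    by_contra h
    exact hmin g hg0 hg ⟨g, hg0, rfl, .inl ⟨x, h, hx⟩⟩
  have hS : ∀ g : E[X], g ≠ 0 → g.natDegree < Nat.find hP →
      ∀ x, g.eval₂ s x = 0 → x ∈ s.range := fun g hg0 hg x hx => by
    by_contra h
    exact hmin g hg0 hg ⟨g, hg0, rfl, .inr ⟨x, h, hx⟩⟩
  obtain ⟨f, hf0, hfn, hf⟩ := Nat.find_spec hP
  obtain ⟨a, b, har, ha, hb, hab⟩ : ∃ a b, a ∉ r.range ∧ f.eval₂ r a = 0 ∧ f.eval₂ s b = 0 ∧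
      ∀ e, SignType.sign (a - r e) = SignType.sign (b - s e) := by
    rcases hf with ⟨a, har, ha⟩ | ⟨b, hbs, hb⟩
    · obtain ⟨b, hb, -, hab⟩ := exists_root_same_cut hr hs hR hS hf0 hfn ha har
      exact ⟨a, b, har, ha, hb, hab⟩
    · obtain ⟨a, ha, har, hab⟩ := exists_root_same_cut hs hr hS hR hf0 hfn hb hbs
      exact ⟨a, b, har, ha, hb, fun e => (hab e).symm⟩
  have hn : f.natDegree ≠ 0 := by
    intro h
    rw [eq_C_of_natDegree_eq_zero h, eval₂_C, map_eq_zero] at ha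
    exact hf0 (by rw [eq_C_of_natDegree_eq_zero h, ha, C_0])
  refine ⟨a, har, b, fun g => ?_⟩
  -- Both a and b are roots of f, so g may be replaced by its remainder modulo f, whose degree is
  -- small enough for the cut to decide the sign.
  have hmod := sign_eval₂_eq_of_cut hr hs hR hS hab (g % f) (hfn ▸ natDegree_mod_lt g hn)
  rw [← EuclideanDomain.div_add_mod g f]
  simpa [eval₂_mul, ha, hb] using hmod

/-- An order-preserving homomorphism from a field `k` to a real closed field extends to every
algebraic real closed extension of `k`. -/
theorem exists_algHom {k : Type*} {R S : Type u} [Field k]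
    [Field R] [LinearOrder R] [IsStrictOrderedRing R] [IsRealClosed R]
    [Field S] [LinearOrder S] [IsStrictOrderedRing S] [IsRealClosed S]
    [Algebra k R] [Algebra k S] [Algebra.IsAlgebraic k R]
    (h : ∀ x, 0 ≤ algebraMap k R x → 0 ≤ algebraMap k S x) : Nonempty (R →ₐ[k] S) := by
  -- Zorn's lemma is applied to the partial embeddings that preserve nonnegativity; for the empty
  -- chain this is the hypothesis on k.
  obtain ⟨L, hL⟩ := zorn_le₀
    {L : IntermediateField.Lifts k R S | ∀ x : L.carrier, 0 ≤ (x : R) → 0 ≤ L.emb x} (by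
      intro c hc hchain
      rcases c.eq_empty_or_nonempty with rfl | hne
      · refine ⟨⊥, fun x hx => ?_, by simp⟩
        obtain ⟨y, hy⟩ := IntermediateField.mem_bot.1 x.2
        have : x = algebraMap k _ y := Subtype.ext hy.symm
        rw [this, AlgHom.commutes]
        exact h y (by rwa [hy])
      · refine ⟨IntermediateField.Lifts.union c hchain, ?_,
          IntermediateField.Lifts.le_union c hchain⟩
        rintro ⟨x, hx⟩ hx0
        have : Nonempty c := hne.to_subtype
        have hdir : Directed (· ≤ ·) fun i : c => i.1.carrier :=
          hchain.directedOn.directed_val.mono_comp _ fun _ _ h => h.1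
        have hx' := hx
        rw [IntermediateField.Lifts.carrier_union, ← SetLike.mem_coe,
          IntermediateField.coe_iSup_of_directed hdir, Set.mem_iUnion] at hx'
        obtain ⟨σ, hσ⟩ := hx'
        obtain ⟨h1, h2⟩ := IntermediateField.Lifts.le_union c hchain σ.2
        have := h2 ⟨x, hσ⟩
        change (IntermediateField.Lifts.union c hchain).emb ⟨x, hx⟩ = _ at this
        rw [this]
        exact hc σ.2 _ hx0)
  have htop : ∀ x, x ∈ L.carrier := by
    by_contra! ⟨x, hx⟩
    let r := algebraMap L.carrier R
    let s := L.emb.toRingHom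
    have hr : StrictMono r := fun _ _ h => h
    have hs : StrictMono s := by
      intro a b hab
      have h1 : 0 ≤ s (b - a) := hL.1 _ (sub_nonneg.2 hab.le)
      rw [map_sub, sub_nonneg] at h1
      exact lt_of_le_of_ne h1 fun h => hab.ne (s.injective h)
    have hxr : x ∉ r.range := by
      rintro ⟨y, rfl⟩
      exact hx y.2
    have hint : ∀ a : R, IsIntegral L.carrier a := fun a =>
      (Algebra.IsIntegral.isIntegral (R := k) a).tower_top
    obtain ⟨a, har, b, hab⟩ := exists_sign_eval₂_eq hr hs hxr
      (minpoly.ne_zero (hint x)) (minpoly.aeval _ x)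
    obtain ⟨L', hLL', haL', hL'⟩ := L.exists_le_mem_of_eval₂_minpoly (hint a) (b := b) (by
      have h1 := hab (minpoly L.carrier a)
      have h2 : (minpoly L.carrier a).eval₂ r a = 0 := minpoly.aeval _ a
      rw [h2, sign_zero] at h1
      exact sign_eq_zero_iff.1 h1.symm)
    -- Since g(a) and g(b) have equal signs, the lift sending a to b still preserves nonnegativity.
    -- Maximality then puts a into the old domain, a contradiction.
    have hle := hL.2 (y := L') (fun y hy => by
      obtain ⟨g, hg, hg'⟩ := hL' y
      rw [← hg']
      rw [← hg] at hy
      have h1 := hab g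
      by_contra! h2
      rw [sign_neg h2, sign_eq_neg_one_iff] at h1
      exact absurd hy (not_le.2 h1)) hLL'
    exact har ⟨⟨a, hle.1 haL'⟩, rfl⟩
  have : L.carrier = ⊤ := eq_top_iff.2 fun x _ => htop x
  exact ⟨L.emb.comp (((IntermediateField.equivOfEq this).trans IntermediateField.topEquiv).symm :
    R →ₐ[k] L.carrier)⟩

/-- Let `B` be a ring with homomorphisms to real closed fields `R` and `S` that induce the same
order on `B`, and let `R` be algebraic over the image of `B`. Then `B → S` factors through `R`. -/
theorem exists_ringHom_comp_eq {B : Type*} {R S : Type u} [CommRing B]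
    [Field R] [LinearOrder R] [IsStrictOrderedRing R] [IsRealClosed R]
    [Field S] [LinearOrder S] [IsStrictOrderedRing S] [IsRealClosed S]
    (f : B →+* R) (g : B →+* S) (h : ∀ b, 0 ≤ f b ↔ 0 ≤ g b)
    (halg : ∀ x : R, ∃ p : B[X], p.map f ≠ 0 ∧ p.eval₂ f x = 0) :
    ∃ ι : R →+* S, ι.comp f = g := by
  have hzero : ∀ b, f b = 0 ↔ g b = 0 := by
    intro b
    have h1 := h b
    have h2 := h (-b)
    rw [map_neg, map_neg, neg_nonneg, neg_nonneg] at h2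
    rw [le_antisymm_iff, le_antisymm_iff, h1, h2]
  -- The kernel is determined by the induced order, so f and g have the same kernel and both extend
  -- to the fraction field of B/I.
  let I := RingHom.ker f
  have hI : I.IsPrime := RingHom.ker_isPrime f
  let f₁ : B ⧸ I →+* R := Ideal.Quotient.lift I f fun b hb => hb
  let g₁ : B ⧸ I →+* S := Ideal.Quotient.lift I g fun b hb => (hzero b).1 hb
  have hf₁ : Function.Injective f₁ := RingHom.kerLift_injective f
  have hg₁ : Function.Injective g₁ := by
    rw [injective_iff_map_eq_zero]
    intro x hx
    obtain ⟨b, rfl⟩ := Ideal.Quotient.mk_surjective x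
    exact Ideal.Quotient.eq_zero_iff_mem.2 ((hzero b).2 hx)
  let k := FractionRing (B ⧸ I)
  let f₂ : k →+* R := IsFractionRing.lift hf₁
  let g₂ : k →+* S := IsFractionRing.lift hg₁
  have hf₂ : ∀ b, f₂ (algebraMap (B ⧸ I) k (Ideal.Quotient.mk I b)) = f b := fun b => by
    simp only [f₂, f₁, IsFractionRing.lift_algebraMap]
    rfl
  have hg₂ : ∀ b, g₂ (algebraMap (B ⧸ I) k (Ideal.Quotient.mk I b)) = g b := fun b => by
    simp only [g₂, g₁, IsFractionRing.lift_algebraMap]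
    rfl
  let := f₂.toAlgebra
  let := g₂.toAlgebra
  have : Algebra.IsAlgebraic k R := ⟨fun x => by
    obtain ⟨p, hp0, hp⟩ := halg x
    let j : B →+* k := (algebraMap (B ⧸ I) k).comp (Ideal.Quotient.mk I)
    have hj : f₂.comp j = f := RingHom.ext hf₂
    refine ⟨p.map j, fun h0 => hp0 ?_, ?_⟩
    · rw [← hj, ← Polynomial.map_map, h0, Polynomial.map_zero]
    · rw [aeval_def, eval₂_map]
      change p.eval₂ (f₂.comp j) x = 0
      rwa [hj]⟩
  obtain ⟨ι⟩ := exists_algHom (k := k) (R := R) (S := S) (by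
    intro x hx
    change 0 ≤ f₂ x at hx
    change 0 ≤ g₂ x
    obtain ⟨p, q, hq, rfl⟩ := IsFractionRing.div_surjective (A := B ⧸ I) x
    obtain ⟨a, rfl⟩ := Ideal.Quotient.mk_surjective p
    obtain ⟨b, rfl⟩ := Ideal.Quotient.mk_surjective q
    rw [map_div₀, hf₂, hf₂] at hx
    rw [map_div₀, hg₂, hg₂]
    -- The sign of a/b is that of ab, which reduces the comparison of orders to elements of B.
    have h1 : 0 ≤ f (a * b) := by
      rw [map_mul]
      rcases div_nonneg_iff.1 hx with h | h
      · exact mul_nonneg h.1 h.2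
      · exact mul_nonneg_of_nonpos_of_nonpos h.1 h.2
    rw [h, map_mul] at h1
    have : g a / g b = g a * g b * (g b)⁻¹ ^ 2 := by
      have : g b ≠ 0 := by
        rw [← hg₂]
        simpa using nonZeroDivisors.ne_zero hq
      field_simp
    rw [this]
    positivity)
  refine ⟨ι.toRingHom, RingHom.ext fun b => ?_⟩
  rw [← hg₂, RingHom.comp_apply, ← hf₂]
  exact ι.commutes _

end IsRealClosed

/-! ### The canonical order of a real closed field -/

namespace IsRealClosed

open Classical in
/-- The order of a real closed field, whose nonnegative elements are the squares. -/
noncomputable abbrev linearOrder (R : Type*) [Field R] [IsRealClosed R] : LinearOrder R where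
  le x y := IsSquare (y - x)
  le_refl x := by simp
  le_trans x y z h h' := by
    have := Sper.isSquare_add_of_isRealClosed h h'
    rwa [sub_add_sub_cancel'] at this
  le_antisymm x y h h' := by
    have := Sper.eq_zero_of_isSquare_neg h (by rwa [neg_sub])
    exact (sub_eq_zero.1 this).symm
  le_total x y := by
    have := IsRealClosed.isSquare_or_isSquare_neg (y - x)
    rwa [neg_sub] at this
  toDecidableLE := Classical.decRel _

theorem isStrictOrderedRing_linearOrder (R : Type*) [Field R] [IsRealClosed R] :
    letI := linearOrder R
    IsStrictOrderedRing R := by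
  let := linearOrder R
  have hle : ∀ x y : R, x ≤ y ↔ IsSquare (y - x) := fun _ _ => Iff.rfl
  have hnonneg : ∀ x : R, 0 ≤ x ↔ IsSquare x := fun x => by rw [hle, sub_zero]
  have : IsOrderedAddMonoid R :=
    { add_le_add_left := fun a b h c => by
        rw [hle] at h ⊢
        simpa using h }
  have : ZeroLEOneClass R := ⟨(hnonneg 1).2 ⟨1, by simp⟩⟩
  exact .of_mul_pos fun a b ha hb =>
    lt_of_le_of_ne ((hnonneg _).2 (((hnonneg a).1 ha.le).mul ((hnonneg b).1 hb.le)))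
      (mul_ne_zero ha.ne' hb.ne').symm

end IsRealClosed

namespace Sper

section OrderPoint

/-- The point of the real spectrum of an ordered field given by its order. -/
def orderPoint (R : Type*) [Field R] [LinearOrder R] [IsStrictOrderedRing R] : Sper R :=
  ⟨RingPreordering.mk' {x : R | 0 ≤ x}
      (fun {x y} (hx : 0 ≤ x) (hy : 0 ≤ y) => (add_nonneg hx hy : 0 ≤ x + y))
      (fun {x y} (hx : 0 ≤ x) (hy : 0 ≤ y) => (mul_nonneg hx hy : 0 ≤ x * y))
      (fun x => (mul_self_nonneg x : 0 ≤ x * x)) (by simp),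
    RingPreordering.isOrdering_iff.2 fun a b h => by
      by_contra! hab
      have ha : a < 0 := not_le.1 hab.1
      have hb : b < 0 := not_le.1 hab.2
      have h' : 0 ≤ -(a * b) := h
      nlinarith [mul_pos_of_neg_of_neg ha hb]⟩

end OrderPoint

/-! ### Consequences of the algebraicity of ρ(β) -/

section Algebraic

variable {A : Type u} [CommRing A] (β : Sper A)

/-- Denominators are cleared, and powers of the variable may be divided out because x ≠ 0. The
nonzero constant term is what makes the points σ(β) closed in their fibres. -/
theorem exists_coeff_zero_ne_zero_and_eval₂_eq_zero {x : β.rho} (hx : x ≠ 0) :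
    ∃ p : A[X], β.ev (p.coeff 0) ≠ 0 ∧ p.eval₂ β.ev x = 0 := by
  let : Algebra (A ⧸ β.supp) β.rho :=
    ((algebraMap β.kappa β.rho).comp (algebraMap (A ⧸ β.supp) β.kappa)).toAlgebra
  have : IsScalarTower (A ⧸ β.supp) β.kappa β.rho := .of_algebraMap_eq fun _ => rfl
  have halg : IsAlgebraic (A ⧸ β.supp) x :=
    (IsFractionRing.isAlgebraic_iff (A ⧸ β.supp) β.kappa β.rho).2
      (Algebra.IsAlgebraic.isAlgebraic x)
  obtain ⟨q, hq0, hq⟩ :=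
    halg.exists_nonzero_coeff_and_aeval_eq_zero (mem_nonZeroDivisors_of_ne_zero hx)
  obtain ⟨p, rfl⟩ := Polynomial.map_surjective _ (Ideal.Quotient.mk_surjective (I := β.supp)) q
  refine ⟨p, ?_, ?_⟩
  · rwa [Ne, ev_eq_zero, ← Ideal.Quotient.eq_zero_iff_mem, ← coeff_map]
  · rw [aeval_def, eval₂_map] at hq
    exact hq

theorem exists_map_ne_zero_and_eval₂_eq_zero (x : β.rho) :
    ∃ p : A[X], p.map β.ev ≠ 0 ∧ p.eval₂ β.ev x = 0 := by
  by_cases hx : x = 0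
  · exact ⟨X, by simp, by simp [hx]⟩
  · obtain ⟨p, hp0, hp⟩ := β.exists_coeff_zero_ne_zero_and_eval₂_eq_zero hx
    exact ⟨p, fun h => hp0 (by rw [← coeff_map, h, coeff_zero]), hp⟩

/-- A root bound whose coefficients come from A. Squaring removes the absolute value, so the bound
becomes a sign condition on an element of A[t]. -/
theorem exists_sq_lt (x : β.rho) : ∃ a b : A, b ∉ β.supp ∧ (β.ev b * x) ^ 2 < β.ev a := by
  obtain ⟨p, hp0, hp⟩ := β.exists_map_ne_zero_and_eval₂_eq_zero x
  have h := abs_map_leadingCoeff_mul_abs_le (RingHom.id β.rho) (p := p.map β.ev) (x := x)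
    (by rwa [eval₂_map, RingHom.id_comp])
  simp only [RingHom.id_apply, coeff_map] at h
  set n := (p.map β.ev).natDegree
  have hle : ∀ c, |β.ev c| ≤ β.ev (c ^ 2 + 1) := fun c => by
    rw [map_add, map_pow, map_one]
    rcases abs_cases (β.ev c) with h | h <;>
      nlinarith [sq_nonneg (β.ev c - 1), sq_nonneg (β.ev c + 1)]
  have h1 := h.trans (Finset.sum_le_sum fun i _ => hle (p.coeff i))
  rw [← map_sum] at h1
  set d := ∑ i ∈ Finset.range (n + 1), (p.coeff i ^ 2 + 1)
  have hl : (p.map β.ev).leadingCoeff = β.ev (p.coeff n) := by rw [← coeff_map]; rfl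
  -- Here n is the degree after mapping to ρ(β), since higher coefficients of p may lie in supp β.
  -- The bound |c| ≤ c² + 1 gives |b x| ≤ d, and adding 1 to d² makes the inequality strict.
  refine ⟨d ^ 2 + 1, p.coeff n, ?_, ?_⟩
  · rw [← ev_eq_zero, ← hl]
    exact leadingCoeff_ne_zero.2 hp0
  · rw [hl, ← abs_mul] at h1
    have := pow_le_pow_left₀ (abs_nonneg _) h1 2
    rw [sq_abs] at this
    rw [map_add, map_pow, map_one]
    linarith

end Algebraic

/-! ### The valuation ring C_{βα} and its residue field -/

section SpecField

variable {A : Type u} [CommRing A] {α β : Sper A} (h : α ⤳ β)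

theorem mem_specRing_of_abs_le {x y : α.rho} (hy : y ∈ specRing h) (hxy : |x| ≤ y) :
    x ∈ specRing h :=
  (isGreatest_convexSubring h).1.ordConnected.out (neg_mem hy) hy (abs_le.1 hxy)

theorem abs_mem_specRing {x : α.rho} (hx : x ∈ specRing h) : |x| ∈ specRing h := by
  rcases abs_choice x with h | h <;> rw [h]
  · exact hx
  · exact neg_mem hx

theorem specProj_eq_zero_iff {x : specRing h} :
    specProj h x = 0 ↔ ¬ ((x : α.rho) ≠ 0 ∧ (x : α.rho)⁻¹ ∈ specRing h) := by
  rw [IsLocalRing.residue_eq_zero_iff, IsLocalRing.mem_maximalIdeal, mem_nonunits_iff, not_iff_not]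
  exact isUnit_iff_inv_mem (C := convexSubring α β) x

theorem specProj_ne_zero_of_one_le {x : specRing h} (hx : 1 ≤ (x : α.rho)) : specProj h x ≠ 0 := by
  have h0 : 0 < (x : α.rho) := by linarith
  rw [Ne, specProj_eq_zero_iff, not_not]
  refine ⟨h0.ne', mem_specRing_of_abs_le h (one_mem _) ?_⟩
  rw [abs_inv, abs_of_pos h0]
  exact inv_le_one_of_one_le₀ hx

theorem specProj_toSpecRing_eq_zero {a : A} :
    specProj h (toSpecRing h a) = 0 ↔ a ∈ β.supp := by
  rw [specProj_eq_zero_iff, ← not_iff_not, not_not]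
  exact ((isConvexFor_iff.1 (isGreatest_convexSubring h).1).2.2 a).symm

/-- The square root y of x in ρ(α) stays in the convex ring because |y| ≤ y² + 1. -/
theorem isSquare_specProj {x : specRing h} (hx : 0 ≤ (x : α.rho)) : IsSquare (specProj h x) := by
  obtain ⟨y, hy⟩ := IsRealClosed.nonneg_iff_isSquare.1 hx
  have hyC : y ∈ specRing h := by
    refine mem_specRing_of_abs_le h (add_mem x.2 (one_mem _)) ?_
    rw [hy]
    rcases abs_cases y with h | h <;> nlinarith [sq_nonneg (y - 1), sq_nonneg (y + 1)]
  refine ⟨specProj h ⟨y, hyC⟩, ?_⟩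
  rw [← map_mul]
  exact congrArg _ (Subtype.ext hy)

/-- A sum of squares lifts to some x ≥ 0, and 1 + x ≥ 1 is a unit, so −1 is not a sum of squares. A
polynomial of odd degree, made monic, lifts to a monic one over C_{βα}; its root in ρ(α) is
integral, hence lies in the valuation ring. -/
instance : IsRealClosed (specField h) := by
  have hsum : ∀ z : specField h, IsSumSq z → ∃ x : specRing h, 0 ≤ (x : α.rho) ∧
      specProj h x = z := by
    intro z hz
    induction hz with
    | zero => exact ⟨0, le_rfl, map_zero _⟩
    | sq_add a _ ih =>
      obtain ⟨x, hx, rfl⟩ := ih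
      obtain ⟨y, rfl⟩ := IsLocalRing.residue_surjective a
      refine ⟨y * y + x, ?_, by rw [map_add, map_mul]⟩
      exact add_nonneg (mul_self_nonneg (y : α.rho)) hx
  have : IsSemireal (specField h) := by
    refine IsSemireal.of_not_isSumSq_neg_one fun hs => ?_
    obtain ⟨x, hx, hx1⟩ := hsum _ hs
    refine specProj_ne_zero_of_one_le h (x := x + 1) ?_ (by rw [map_add, hx1, map_one]; ring)
    exact le_add_of_nonneg_left hx
  refine { isSquare_or_isSquare_neg := fun z => ?_, exists_isRoot_of_odd_natDegree := fun {f} hf => ?_ }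
  · obtain ⟨x, rfl⟩ := IsLocalRing.residue_surjective z
    rcases le_total 0 (x : α.rho) with hx | hx
    · exact .inl (isSquare_specProj h hx)
    · refine .inr ?_
      rw [← map_neg]
      exact isSquare_specProj h (neg_nonneg.2 hx)
  · have hf0 : f ≠ 0 := by rintro rfl; simp at hf
    obtain ⟨F, hF, hdeg, hmonic⟩ := lifts_and_natDegree_eq_and_monic (f := specProj h)
      (p := f * C f.leadingCoeff⁻¹)
      (by
        rw [lifts_iff_coeff_lifts]
        exact fun _ => IsLocalRing.residue_surjective _) (monic_mul_leadingCoeff_inv hf0)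
    rw [natDegree_mul_leadingCoeff_inv _ hf0] at hdeg
    obtain ⟨x, hx⟩ := IsRealClosed.exists_isRoot_of_odd_natDegree
      (f := F.map (algebraMap (specRing h) α.rho)) (by rwa [hmonic.natDegree_map, hdeg])
    rw [IsRoot.def, eval_map] at hx
    obtain ⟨y, rfl⟩ := IsIntegrallyClosed.algebraMap_eq_of_integral (R := specRing h)
      (K := α.rho) (x := x) ⟨F, hmonic, hx⟩
    rw [eval₂_hom, map_eq_zero_iff _ (IsFractionRing.injective (specRing h) α.rho)] at hx
    refine ⟨specProj h y, ?_⟩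
    have h1 : (F.map (specProj h)).eval (specProj h y) = 0 := by
      rw [eval_map, eval₂_hom, hx, map_zero]
    rw [hF, eval_mul, eval_C] at h1
    exact (mul_eq_zero.1 h1).resolve_right (by simpa using hf0)

noncomputable instance : LinearOrder (specField h) := IsRealClosed.linearOrder _

instance : IsStrictOrderedRing (specField h) := IsRealClosed.isStrictOrderedRing_linearOrder _

theorem specProj_nonneg {x : specRing h} (hx : 0 ≤ (x : α.rho)) : 0 ≤ specProj h x :=
  IsRealClosed.nonneg_iff_isSquare.2 (isSquare_specProj h hx)

/-- If a ∈ β is not in α, then −a ∈ α ⊆ β, so a ∈ supp β and its image is zero. The converse follows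
because the kernel is supp β. -/
theorem specProj_toSpecRing_nonneg_iff {a : A} :
    0 ≤ specProj h (toSpecRing h a) ↔ a ∈ β := by
  have hβ : ∀ a ∈ β, 0 ≤ specProj h (toSpecRing h a) := by
    intro a ha
    by_cases haα : a ∈ α
    · exact specProj_nonneg h (α.ev_nonneg.2 haα)
    · have h1 := specializes_iff.1 h _ ((α.mem_or_neg_mem a).resolve_left haα)
      exact ((specProj_toSpecRing_eq_zero h).2 (mem_supp.2 ⟨ha, h1⟩)).ge
  refine ⟨fun ha => ?_, hβ a⟩
  by_contra hna
  have h1 := (β.mem_or_neg_mem a).resolve_left hna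
  have h2 := hβ _ h1
  rw [map_neg, map_neg, neg_nonneg] at h2
  exact hna (mem_supp.1 ((specProj_toSpecRing_eq_zero h).1 (le_antisymm h2 ha))).1

/-- By maximality of `C_{βα}`, its maximal ideal is the smallest convex prime ideal that contains
the image of `supp β`. -/
theorem exists_pow_le_of_specProj_eq_zero {x : specRing h} (hx : specProj h x = 0) :
    ∃ n : ℕ, ∃ b ∈ β.supp, (x : α.rho) ^ (2 * n) ≤ α.ev b := by
  by_cases hx0 : (x : α.rho) = 0
  · exact ⟨1, 0, zero_mem _, by simp [hx0]⟩
  have hxinv : (x : α.rho)⁻¹ ∉ specRing h := fun hmem =>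
    (specProj_eq_zero_iff h).1 hx ⟨hx0, hmem⟩
  -- D is the localization C_{βα}[1/x]. It is convex and strictly larger than C_{βα}, so by
  -- maximality it has no maximal ideal over supp β.
  let D : Subring α.rho :=
    { carrier := {z | ∃ n : ℕ, z * (x : α.rho) ^ n ∈ specRing h}
      zero_mem' := ⟨0, by simp⟩
      one_mem' := ⟨0, by simp⟩
      neg_mem' := by
        rintro z ⟨n, hz⟩
        exact ⟨n, by rw [neg_mul]; exact neg_mem hz⟩
      add_mem' := by
        rintro z w ⟨n, hz⟩ ⟨m, hw⟩
        refine ⟨n + m, ?_⟩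
        have : (z + w) * (x : α.rho) ^ (n + m) =
            z * (x : α.rho) ^ n * (x : α.rho) ^ m + w * (x : α.rho) ^ m * (x : α.rho) ^ n := by ring
        rw [this]
        exact add_mem (mul_mem hz (pow_mem x.2 m)) (mul_mem hw (pow_mem x.2 n))
      mul_mem' := by
        rintro z w ⟨n, hz⟩ ⟨m, hw⟩
        refine ⟨n + m, ?_⟩
        have : z * w * (x : α.rho) ^ (n + m) =
            z * (x : α.rho) ^ n * (w * (x : α.rho) ^ m) := by ring
        rw [this]
        exact mul_mem hz hw }
  have hCD : ∀ z ∈ specRing h, z ∈ D := fun z hz => ⟨0, by simpa using hz⟩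
  have hD : (D : Set α.rho).OrdConnected := by
    refine ⟨?_⟩
    rintro z ⟨n, hz⟩ w ⟨m, hw⟩ y ⟨hzy, hyw⟩
    refine ⟨n + m, ?_⟩
    have hz' := abs_mem_specRing h (mul_mem hz (pow_mem x.2 m))
    have hw' := abs_mem_specRing h (mul_mem hw (pow_mem x.2 n))
    refine mem_specRing_of_abs_le h (add_mem hz' hw') ?_
    rw [mul_assoc, ← pow_add, mul_assoc, ← pow_add, add_comm m n, abs_mul, abs_mul, abs_mul,
      ← add_mul]
    refine mul_le_mul_of_nonneg_right ?_ (abs_nonneg _)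
    rcases abs_cases z with hx | hx <;> rcases abs_cases y with hy | hy <;>
      rcases abs_cases w with hz | hz <;> linarith
  have hnot : ¬ IsConvexFor α β D := by
    intro hc
    apply hxinv
    refine (isGreatest_convexSubring h).2 hc ?_
    exact ⟨1, by simp [hx0]⟩
  -- The only way D can fail is that some a in supp β becomes invertible in it.
  obtain ⟨a, ha, ha0, n, hn⟩ : ∃ a ∈ β.supp, α.ev a ≠ 0 ∧ (α.ev a)⁻¹ ∈ D := by
    by_contra! hcon
    apply hnot
    refine isConvexFor_iff.2 ⟨hD, fun a => hCD _ ((isGreatest_convexSubring h).1.ev_mem a),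
      fun a => ⟨fun ha => ?_, fun h1 h2 => hcon a h2 h1.1 h1.2⟩⟩
    have h1 := ((isConvexFor_iff.1 (isGreatest_convexSubring h).1).2.2 a).1 ha
    exact ⟨h1.1, hCD _ h1.2⟩
  set c := (α.ev a)⁻¹ * (x : α.rho) ^ n
  -- The product cx lies in the maximal ideal, and an element of absolute value greater than 1 would
  -- be a unit. Hence |x^(n+1)| ≤ |a(α)|, which is squared.
  have hcx : |c * x| ≤ 1 := by
    by_contra! hlt
    have h1 : specProj h (⟨c, hn⟩ * x) = 0 := by rw [map_mul, hx, mul_zero]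
    refine (specProj_eq_zero_iff h).1 h1 ⟨?_, mem_specRing_of_abs_le h (one_mem _) ?_⟩
    · exact abs_pos.1 (lt_trans one_pos hlt)
    · rw [abs_inv]
      exact inv_le_one_of_one_le₀ hlt.le
  refine ⟨n + 1, a ^ 2, Ideal.pow_mem_of_mem _ ha 2 two_pos, ?_⟩
  have h2 : (x : α.rho) ^ (2 * (n + 1)) = (c * x) ^ 2 * α.ev a ^ 2 := by
    simp only [c]
    field_simp
    ring
  rw [h2, map_pow]
  exact mul_le_of_le_one_left (sq_nonneg _) ((sq_le_one_iff_abs_le_one _).2 hcx)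

end SpecField

end Sper

/-! ### Specializations in the fibres and the two implications -/

namespace Sper

section Main

variable {A : Type u} [CommRing A] {α β : Sper A}

theorem mem_sectionPoint {r : α.rho} {p : A[X]} :
    p ∈ sectionPoint α r ↔ 0 ≤ p.eval₂ α.ev r := Iff.rfl

theorem mem_supp_sectionPoint {r : α.rho} {p : A[X]} :
    p ∈ (sectionPoint α r).supp ↔ p.eval₂ α.ev r = 0 := by
  rw [mem_supp, mem_sectionPoint, mem_sectionPoint, eval₂_neg, neg_nonneg, le_antisymm_iff,
    and_comm]

theorem mem_of_proj_eq {γ : Sper A[X]} (hγ : proj γ = β) {a : A} : a ∈ β ↔ C a ∈ γ := by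
  rw [← hγ]; rfl

theorem mem_supp_of_proj_eq {γ : Sper A[X]} (hγ : proj γ = β) {a : A} :
    a ∈ β.supp ↔ C a ∈ γ.supp := by
  rw [mem_supp, mem_supp, mem_of_proj_eq hγ, mem_of_proj_eq hγ, C_neg]

/-- The points `σ(β)` are closed in the fibre. -/
theorem eq_sectionPoint_of_le {γ : Sper A[X]} (hγ : proj γ = β) {s : β.rho}
    (hle : ∀ p ∈ sectionPoint β s, p ∈ γ) : γ = sectionPoint β s := by
  refine SetLike.ext fun p => ⟨fun hp => ?_, hle p⟩
  by_contra hps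
  rw [mem_sectionPoint, not_le] at hps
  have hsupp : ∀ q ∈ (sectionPoint β s).supp, q ∈ γ.supp := fun q hq =>
    mem_supp.2 ⟨hle _ (mem_supp.1 hq).1, hle _ (mem_supp.1 hq).2⟩
  have hpγ : p ∈ γ.supp := mem_supp.2 ⟨hp, hle _ (by
    rw [mem_sectionPoint, eval₂_neg]; exact neg_nonneg.2 hps.le)⟩
  -- Here p ∈ supp γ although p(s) ≠ 0. From w(p(s)) = 0 it follows that w(p) ∈ supp γ, so the
  -- constant term of w lies in supp β, contrary to its choice.
  obtain ⟨w, hw0, hw⟩ := β.exists_coeff_zero_ne_zero_and_eval₂_eq_zero hps.ne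
  have h1 : w.eval₂ C p ∈ γ.supp := by
    apply hsupp
    rw [mem_supp_sectionPoint, ← coe_eval₂RingHom, hom_eval₂]
    have : (eval₂RingHom β.ev s).comp C = β.ev := RingHom.ext fun a => eval₂_C _ _
    rw [this]
    exact hw
  have h2 : C (w.coeff 0) ∈ γ.supp := by
    have : w.eval₂ C p = w.divX.eval₂ C p * p + C (w.coeff 0) := by
      conv_lhs => rw [← divX_mul_X_add w]
      simp
    rw [this] at h1
    exact (Submodule.add_mem_iff_right _ (Ideal.mul_mem_left _ _ hpγ)).1 h1
  exact hw0 (β.ev_eq_zero.2 ((mem_supp_of_proj_eq hγ).2 h2))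

variable (h : α ⤳ β)

theorem coe_eval₂_toSpecRing (r : specRing h) (p : A[X]) :
    ((p.eval₂ (toSpecRing h) r : specRing h) : α.rho) = p.eval₂ α.ev r :=
  hom_eval₂ p (toSpecRing h) (specRing h).subtype r

theorem specProj_eval₂ (r : specRing h) (p : A[X]) :
    specProj h (p.eval₂ (toSpecRing h) r) =
      p.eval₂ ((specProj h).comp (toSpecRing h)) (specProj h r) :=
  hom_eval₂ p (toSpecRing h) (specProj h) r

/-- If the value `r` at `α` is mapped to the value `s` at `β`, then `s` is the only specialization
of `r` in the fibre over `β`. -/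
theorem specializations_eq_singleton {ι : β.rho →+* specField h} (hι : IsComparison h ι)
    {r : specRing h} {s : β.rho} (hrs : specProj h r = ι s) :
    {γ : Sper A[X] | γ ∈ proj ⁻¹' {β} ∧ sectionPoint α r ⤳ γ} = {sectionPoint β s} := by
  have heval : ∀ p : A[X], specProj h (p.eval₂ (toSpecRing h) r) = ι (p.eval₂ β.ev s) := by
    intro p
    rw [specProj_eval₂, hrs, ← hι, hom_eval₂]
  have hιpos : ∀ x : β.rho, 0 < x → 0 < ι x := fun x hx =>
    lt_of_le_of_ne (IsRealClosed.nonneg_iff_isSquare.2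
      ((IsRealClosed.nonneg_iff_isSquare.1 hx.le).map ι)) (by rw [Ne, eq_comm, map_eq_zero]; exact hx.ne')
  -- If p(r) ≤ 0, then its residue ι(p(s)) is also ≤ 0, because the projection preserves
  -- nonnegativity.
  have hpos : ∀ p : A[X], 0 < p.eval₂ β.ev s → 0 < p.eval₂ α.ev (r : α.rho) := by
    intro p hp
    by_contra! hle
    rw [← coe_eval₂_toSpecRing h, ← neg_nonneg] at hle
    have h1 := specProj_nonneg h (x := -p.eval₂ (toSpecRing h) r) hle
    rw [map_neg, heval, neg_nonneg] at h1
    exact absurd (hιpos _ hp) (not_lt.2 h1)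
  refine Set.eq_singleton_iff_unique_mem.2 ⟨⟨proj_sectionPoint β s, ?_⟩, ?_⟩
  · rw [specializes_iff]
    intro p hp
    rw [mem_sectionPoint] at hp ⊢
    by_contra! hlt
    have := hpos (-p) (by rw [eval₂_neg]; exact neg_pos.2 hlt)
    rw [eval₂_neg, neg_pos] at this
    exact absurd hp (not_le.2 this)
  · rintro γ ⟨hγ, hspec⟩
    replace hγ : proj γ = β := hγ
    rw [specializes_iff] at hspec
    refine eq_sectionPoint_of_le hγ fun p hp => ?_
    rcases lt_or_eq_of_le (mem_sectionPoint.1 hp) with hlt | heq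
    · exact hspec p (mem_sectionPoint.2 (hpos p hlt).le)
    -- When p(s) = 0, the inequality p^(2n) ≤ b holds at r and hence at γ, where b vanishes; so p ∈
    -- supp γ.
    · obtain ⟨n, b, hb, hle⟩ := exists_pow_le_of_specProj_eq_zero h
        (x := p.eval₂ (toSpecRing h) r) (by rw [heval, ← heq, map_zero])
      rw [coe_eval₂_toSpecRing] at hle
      have h1 : C b - p ^ (2 * n) ∈ γ := hspec _ (mem_sectionPoint.2 (by
        rw [eval₂_sub, eval₂_C, eval₂_pow]
        exact sub_nonneg.2 hle))
      have h2 : -p ^ (2 * n) ∈ γ := by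
        have : -p ^ (2 * n) = (C b - p ^ (2 * n)) + -C b := by ring
        rw [this]
        exact add_mem h1 (mem_supp.1 ((mem_supp_of_proj_eq hγ).1 hb)).2
      have h3 : p ^ (2 * n) ∈ γ.supp :=
        mem_supp.2 ⟨by rw [mul_comm, pow_mul]; exact γ.sq_mem _, h2⟩
      exact (mem_supp.1 (Ideal.IsPrime.mem_of_pow_mem inferInstance _ h3)).1

/-- The inequality (bt)² ≥ a is a closed condition, so if it held at r it would hold at s, contrary
to the choice of a and b. Thus br is bounded by an element of C_{βα}, in which b is a unit. -/
theorem mem_specRing_of_specializes {r : α.rho} {s : β.rho}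
    (hrs : sectionPoint α r ⤳ sectionPoint β s) : r ∈ specRing h := by
  obtain ⟨a, b, hb, hlt⟩ := β.exists_sq_lt s
  have hlt' : (α.ev b * r) ^ 2 < α.ev a := by
    by_contra! hle
    have h1 := specializes_iff.1 hrs (C b ^ 2 * X ^ 2 - C a) (mem_sectionPoint.2 (by
      simp only [eval₂_sub, eval₂_mul, eval₂_pow, eval₂_C, eval₂_X, sub_nonneg]
      rwa [← mul_pow]))
    rw [mem_sectionPoint] at h1
    simp only [eval₂_sub, eval₂_mul, eval₂_pow, eval₂_C, eval₂_X, sub_nonneg] at h1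
    rw [mul_pow] at hlt
    exact absurd hlt (not_lt.2 h1)
  obtain ⟨hb0, hbinv⟩ := ((isConvexFor_iff.1 (isGreatest_convexSubring h).1).2.2 b).1 hb
  have hmem : α.ev a + 1 ∈ specRing h := add_mem (toSpecRing h a).2 (one_mem _)
  have h2 : α.ev b * r ∈ specRing h := by
    refine mem_specRing_of_abs_le h hmem ?_
    rcases abs_cases (α.ev b * r) with h | h <;>
      nlinarith [sq_nonneg (α.ev b * r - 1), sq_nonneg (α.ev b * r + 1)]
  rw [← inv_mul_cancel_left₀ hb0 r]
  exact mul_mem hbinv h2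

/-- If the value `s` at `β` is the only specialization of the value `r` at `α` in the fibre over
`β`, then `r` is mapped to `s`. -/
theorem exists_isComparison_of_specializations_eq_singleton {r : specRing h} {s : β.rho}
    (hrs : {γ : Sper A[X] | γ ∈ proj ⁻¹' {β} ∧ sectionPoint α r ⤳ γ} = {sectionPoint β s}) :
    ∃ ι : β.rho →+* specField h, IsComparison h ι ∧ specProj h r = ι s := by
  let g : A[X] →+* specField h :=
    eval₂RingHom ((specProj h).comp (toSpecRing h)) (specProj h r)
  have hgC : ∀ a, g (C a) = specProj h (toSpecRing h a) := fun a => eval₂_C _ _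
  -- This is the point defined by the residue of r. It specializes r and lies over β, so uniqueness
  -- identifies it with the point s.
  let γ : Sper A[X] := comap g (orderPoint (specField h))
  have hγ : γ = sectionPoint β s := by
    rw [← Set.mem_singleton_iff, ← hrs]
    refine ⟨?_, specializes_iff.2 fun p hp => ?_⟩
    · refine SetLike.ext fun a => ?_
      rw [← specProj_toSpecRing_nonneg_iff h, ← hgC]
      rfl
    · change 0 ≤ g p
      change 0 ≤ p.eval₂ ((specProj h).comp (toSpecRing h)) (specProj h r)
      rw [← specProj_eval₂]
      refine specProj_nonneg h ?_
      rw [coe_eval₂_toSpecRing]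
      exact hp
  obtain ⟨ι, hι⟩ := IsRealClosed.exists_ringHom_comp_eq (eval₂RingHom β.ev s) g
    (fun p => by
      have : p ∈ sectionPoint β s ↔ p ∈ γ := by rw [hγ]
      exact this)
    (fun x => by
      obtain ⟨p, hp0, hp⟩ := β.exists_map_ne_zero_and_eval₂_eq_zero x
      have hC : (eval₂RingHom β.ev s).comp C = β.ev := RingHom.ext fun a => eval₂_C _ _
      -- Algebraicity over the image of A[t] already follows from constant coefficients in A.
      refine ⟨p.map C, ?_, ?_⟩
      · rwa [Polynomial.map_map, hC]
      · rwa [eval₂_map, hC])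
  refine ⟨ι, RingHom.ext fun a => ?_, ?_⟩
  · have := RingHom.congr_fun hι (C a)
    rw [hgC] at this
    simpa using this
  · have := RingHom.congr_fun hι X
    simpa [g] using this.symm

end Main

end Sper

end

theorem theorem25 {A : Type*} [CommRing A] {K : Set (Sper A)} (hK : Sper.IsProconstructible K)
    (σ : ∀ α : K, α.1.rho) :
    Sper.IsCompatible σ ↔
      ∀ α β : K, α.1 ⤳ β.1 →
        {γ : Sper (Polynomial A) | γ ∈ Sper.proj ⁻¹' {β.1} ∧
          Sper.sectionPoint α.1 (σ α) ⤳ γ} = {Sper.sectionPoint β.1 (σ β)} := by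
  constructor
  · intro hσ α β h
    obtain ⟨hmem, ι, hι, heq⟩ := hσ α β h
    exact Sper.specializations_eq_singleton h hι (r := ⟨σ α, hmem⟩) heq
  · intro hσ α β h
    have hspec : Sper.sectionPoint α.1 (σ α) ⤳ Sper.sectionPoint β.1 (σ β) :=
      ((hσ α β h).symm ▸ Set.mem_singleton _ : Sper.sectionPoint β.1 (σ β) ∈
        {γ | γ ∈ Sper.proj ⁻¹' {β.1} ∧ Sper.sectionPoint α.1 (σ α) ⤳ γ}).2
    -- Membership in C_{βα} needs only that σ(β) is a specialization of σ(α); uniqueness then gives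
    -- the equality of residues.
    have hmem := Sper.mem_specRing_of_specializes h hspec
    exact ⟨hmem, Sper.exists_isComparison_of_specializations_eq_singleton h
      (r := ⟨σ α, hmem⟩) (hσ α β h)⟩
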